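/- Let $X\in\mathbb R^{Q\times N}$ have linearly independent columns, let $\mathcal B$ be a partition of $\{1,\dots,N\}$ into non-empty blocks, and let $\lambda>0$. For $v\in\mathbb R^N$ and $b\in\mathcal B$ let $v_b=(v_i)_{i\in b}$, let $\|\cdot\|$ be the Euclidean norm, and let $\mathrm{bs}(\beta)=\{b\in\mathcal B:\beta_b\ne0\}$ be the block support of $\beta$. For a set $I$ of blocks, $X_I$ (resp. $\beta_I$) consists of the columns of $X$ (entries of $\beta$) with index in a block of $I$, and $X_b=X_{\{b\}}$. For every $y\in\mathbb R^Q$ the group Lasso $$\min_{\beta\in\mathbb R^N}\ \tfrac12\|y-X\beta\|^2+\lambda\sum_{b\in\mathcal B}\|\beta_b\|$$ has exactly one solution $\hat\beta(y)$; put $\hat\mu(y)=X\hat\beta(y)$. For $I\subset\mathcal B$ and $b\in\mathcal B\setminus I$ let $\mathcal H_{I,b}$ be the set of all $y\in\mathbb R^Q$ for which there is $\beta\in\mathbb R^N$ with $\mathrm{bs}(\beta)=I$ such that $r=y-X_I\beta_I$ satisfies $\|X_b^Tr\|=\lambda$ and $X_c^Tr=\lambda\beta_c/\|\beta_c\|$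 for all $c\in I$. Let $\mathcal H=\bigcup_{I\subset\mathcal B}\bigcup_{b\in\mathcal B\setminus I}\mathcal H_{I,b}$. For $\beta\in\mathbb R^N$ with block support $I$ let $\delta_\beta v=(v_b/\|\beta_b\|)_{b\in I}$ and $P_\beta v=(P_{\beta_b^\perp}v_b)_{b\in I}$ on vectors $v$ indexed by the indices in the blocks of $I$, where $P_{\beta_b^\perp}$ is the orthogonal projection onto the orthogonal complement of $\mathbb R\beta_b$. With $\beta=\hat\beta(y)$ and $I=\mathrm{bs}(\hat\beta(y))$ let $$d(y)=\big(X_I^TX_I+\lambda\,\delta_{\hat\beta(y)}\circ P_{\hat\beta(y)}\big)^{-1}X_I^T .$$ Then: 1. The map $\hat\mu$ is of class $C^1$ on $\mathbb R^Q\setminus\mathcal H$ (that is, in a neighbourhood of each point of this set), and for all $y\notin\mathcal H$ the inverse in $d(y)$ exists and $\operatorname{div}\hat\mu(y)=\operatorname{tr}(X_I\,d(y))$. 2. The set $\mathcal H$ has Lebesgue measure zero. 3. Let $\beta_0\in\mathbb R^N$, $\sigma>0$ and $y=X\beta_0+\varepsilon$ with $\varepsilon\sim\mathcal N(0,\sigma^2I_Q)$.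 Then $y$ and $\hat\mu(y)$ are square integrable, $\operatorname{div}\hat\mu(y)=\operatorname{tr}(X_I\,d(y))$ almost surely, and both sides of this equation are integrable unbiased estimators of the degrees of freedom: $\mathbb E[\operatorname{div}\hat\mu(y)]=\mathbb E[\operatorname{tr}(X_I\,d(y))]=\sum_{i=1}^Q\operatorname{cov}(y_i,\hat\mu(y)_i)/\sigma^2$. -/

import Mathlib

open MeasureTheory ProbabilityTheory
open scoped Matrix

namespace GroupLasso

noncomputable section

/-- The subvector `v_b` of `v` with entries indexed by `b`, with its Euclidean norm. -/
def blockVec {N : ℕ} (v : Fin N → ℝ) (b : Finset (Fin N)) : EuclideanSpace ℝ b :=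
  WithLp.toLp 2 fun i => v i

/-- The matrix `X_J` formed by the columns of `X` with index in `J`. -/
def cols {Q N : ℕ} (X : Matrix (Fin Q) (Fin N) ℝ) (J : Finset (Fin N)) : Matrix (Fin Q) J ℝ :=
  X.submatrix id Subtype.val

/-- The set of all indices that lie in one of the blocks of `I`. -/
def indices {N : ℕ} (I : Finset (Finset (Fin N))) : Finset (Fin N) := I.biUnion id

/-- The group Lasso objective; the blocks are the parts of the partition `B` of the indices. -/
def objective {Q N : ℕ} (X : Matrix (Fin Q) (Fin N) ℝ)
    (B : Finpartition (Finset.univ : Finset (Fin N))) (lam : ℝ)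
    (y : EuclideanSpace ℝ (Fin Q)) (β : EuclideanSpace ℝ (Fin N)) : ℝ :=
  1 / 2 * ‖y - WithLp.toLp 2 (X *ᵥ ⇑β)‖ ^ 2 + lam * ∑ b ∈ B.parts, ‖blockVec β b‖

/-- `β` is a global minimizer of the group Lasso objective. -/
def IsSolution {Q N : ℕ} (X : Matrix (Fin Q) (Fin N) ℝ)
    (B : Finpartition (Finset.univ : Finset (Fin N))) (lam : ℝ)
    (y : EuclideanSpace ℝ (Fin Q)) (β : EuclideanSpace ℝ (Fin N)) : Prop :=
  ∀ β' : EuclideanSpace ℝ (Fin N), objective X B lam y β ≤ objective X B lam y β'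

/-- The solution `β̂(y)` of the group Lasso. -/
def solution {Q N : ℕ} (X : Matrix (Fin Q) (Fin N) ℝ)
    (B : Finpartition (Finset.univ : Finset (Fin N))) (lam : ℝ)
    (y : EuclideanSpace ℝ (Fin Q)) : EuclideanSpace ℝ (Fin N) :=
  Classical.epsilon (IsSolution X B lam y)

/-- The prediction `μ̂(y) = X β̂(y)`. -/
def prediction {Q N : ℕ} (X : Matrix (Fin Q) (Fin N) ℝ)
    (B : Finpartition (Finset.univ : Finset (Fin N))) (lam : ℝ)
    (y : EuclideanSpace ℝ (Fin Q)) : EuclideanSpace ℝ (Fin Q) :=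
  WithLp.toLp 2 (X *ᵥ ⇑(solution X B lam y))

open Classical in
/-- The block support of `β`: the set of the blocks on which `β` does not vanish. -/
def bsupp {N : ℕ} (B : Finpartition (Finset.univ : Finset (Fin N)))
    (β : EuclideanSpace ℝ (Fin N)) : Finset (Finset (Fin N)) :=
  B.parts.filter fun b => ‖blockVec β b‖ ≠ 0

/-- Extension of a vector on the index set `J` by zero. -/
def extend {N : ℕ} {J : Finset (Fin N)} (v : J → ℝ) : Fin N → ℝ :=
  fun i => if h : i ∈ J then v ⟨i, h⟩ else 0

/-- `δ_β : v ↦ (v_b / ‖β_b‖)_b` on the vectors indexed by `J`, a union of blocks.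
The block that contains `i` is `B.part i`. -/
def deltaOp {N : ℕ} (B : Finpartition (Finset.univ : Finset (Fin N)))
    (β : EuclideanSpace ℝ (Fin N)) (J : Finset (Fin N)) : (J → ℝ) →ₗ[ℝ] (J → ℝ) where
  toFun v := fun i => v i / ‖blockVec β (B.part i)‖
  map_add' v w := by
    funext i
    simp [add_div]
  map_smul' c v := by
    funext i
    simp [mul_div_assoc]

/-- `P_β : v ↦ (P_{β_b^⊥} v_b)_b` on the vectors indexed by `J`, a union of blocks, with
`P_{β_b^⊥}` the orthogonal projection onto the orthogonal complement of the line of `β_b`. -/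
def projOp {N : ℕ} (B : Finpartition (Finset.univ : Finset (Fin N)))
    (β : EuclideanSpace ℝ (Fin N)) (J : Finset (Fin N)) : (J → ℝ) →ₗ[ℝ] (J → ℝ) where
  toFun v := fun i =>
    ((Submodule.span ℝ {blockVec β (B.part i)})ᗮ.starProjection
      (blockVec (extend v) (B.part i))) ⟨i, B.mem_part (Finset.mem_univ _)⟩
  map_add' v w := by
    funext i
    have h : blockVec (extend (v + w)) (B.part i)
        = blockVec (extend v) (B.part i) + blockVec (extend w) (B.part i) := by
      ext j
      simp only [blockVec, extend, PiLp.add_apply]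
      split_ifs <;> simp
    rw [h, map_add]
    rfl
  map_smul' c v := by
    funext i
    have h : blockVec (extend (c • v)) (B.part i)
        = c • blockVec (extend v) (B.part i) := by
      ext j
      simp only [blockVec, extend, PiLp.smul_apply]
      split_ifs <;> simp
    rw [h, map_smul]
    rfl

/-- The matrix `X_Iᵀ X_I + λ δ_β ∘ P_β`, where `I` is the block support of `β`. -/
def hessian {Q N : ℕ} (X : Matrix (Fin Q) (Fin N) ℝ)
    (B : Finpartition (Finset.univ : Finset (Fin N))) (lam : ℝ) (β : EuclideanSpace ℝ (Fin N)) :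
    Matrix (indices (bsupp B β)) (indices (bsupp B β)) ℝ :=
  (cols X (indices (bsupp B β)))ᵀ * cols X (indices (bsupp B β))
    + lam • LinearMap.toMatrix' (deltaOp B β (indices (bsupp B β)) ∘ₗ
        projOp B β (indices (bsupp B β)))

/-- `d(y) = (X_Iᵀ X_I + λ δ_{β̂(y)} ∘ P_{β̂(y)})⁻¹ X_Iᵀ`, where `I` is the block support
of `β̂(y)`. -/
def dMatrix {Q N : ℕ} (X : Matrix (Fin Q) (Fin N) ℝ)
    (B : Finpartition (Finset.univ : Finset (Fin N))) (lam : ℝ) (y : EuclideanSpace ℝ (Fin Q)) :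
    Matrix (indices (bsupp B (solution X B lam y))) (Fin Q) ℝ :=
  (hessian X B lam (solution X B lam y))⁻¹
    * (cols X (indices (bsupp B (solution X B lam y))))ᵀ

/-- The number `tr(X_I d(y))`, where `I` is the block support of `β̂(y)`. -/
def dofEstimate {Q N : ℕ} (X : Matrix (Fin Q) (Fin N) ℝ)
    (B : Finpartition (Finset.univ : Finset (Fin N))) (lam : ℝ)
    (y : EuclideanSpace ℝ (Fin Q)) : ℝ :=
  (cols X (indices (bsupp B (solution X B lam y))) * dMatrix X B lam y).trace

/-- The residual `y - X_I β_I`. -/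
def residual {Q N : ℕ} (X : Matrix (Fin Q) (Fin N) ℝ) (I : Finset (Finset (Fin N)))
    (y : EuclideanSpace ℝ (Fin Q)) (β : EuclideanSpace ℝ (Fin N)) : EuclideanSpace ℝ (Fin Q) :=
  y - WithLp.toLp 2 (cols X (indices I) *ᵥ ⇑(blockVec β (indices I)))

/-- The set `H_{I,b}` of the `y` for which there is a `β` with block support `I` such that, for
`r = y - X_I β_I`, one has `‖X_bᵀ r‖ = λ`, and `X_cᵀ r = λ β_c / ‖β_c‖` for all `c ∈ I`. -/
def transitionPiece {Q N : ℕ} (X : Matrix (Fin Q) (Fin N) ℝ)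
    (B : Finpartition (Finset.univ : Finset (Fin N))) (lam : ℝ)
    (I : Finset (Finset (Fin N))) (b : Finset (Fin N)) : Set (EuclideanSpace ℝ (Fin Q)) :=
  {y | ∃ β : EuclideanSpace ℝ (Fin N), bsupp B β = I ∧
    ‖(WithLp.toLp 2 ((cols X b)ᵀ *ᵥ ⇑(residual X I y β)) : EuclideanSpace ℝ b)‖ = lam ∧
    ∀ c ∈ I, (WithLp.toLp 2 ((cols X c)ᵀ *ᵥ ⇑(residual X I y β)) : EuclideanSpace ℝ c)
      = (lam / ‖blockVec β c‖) • blockVec β c}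

/-- The transition set `H`, the union of the sets `H_{I,b}` over all sets `I` of blocks and all
blocks `b ∉ I`. -/
def transitionSet {Q N : ℕ} (X : Matrix (Fin Q) (Fin N) ℝ)
    (B : Finpartition (Finset.univ : Finset (Fin N))) (lam : ℝ) :
    Set (EuclideanSpace ℝ (Fin Q)) :=
  ⋃ I ∈ B.parts.powerset, ⋃ b ∈ B.parts \ I, transitionPiece X B lam I b

/-- The divergence of a vector field: the trace of its derivative. -/
def divergence {Q : ℕ} (f : EuclideanSpace ℝ (Fin Q) → EuclideanSpace ℝ (Fin Q))
    (y : EuclideanSpace ℝ (Fin Q)) : ℝ :=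
  ∑ i, (fderiv ℝ f y (EuclideanSpace.single i 1)) i

/-- The degrees of freedom `∑ i, cov(y_i, μ̂(y)_i) / σ²` of an estimator `μ̂`, where `y` is a
random vector with noise level `σ`. -/
def dof {Q : ℕ} {Ω : Type*} [MeasurableSpace Ω] (P : Measure Ω) (σ : ℝ)
    (y : Ω → EuclideanSpace ℝ (Fin Q))
    (muHat : EuclideanSpace ℝ (Fin Q) → EuclideanSpace ℝ (Fin Q)) : ℝ :=
  ∑ i, cov[fun ω => y ω i, fun ω => muHat (y ω) i; P] / σ ^ 2

/-- `T` is an unbiased estimator of the number `θ`. -/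
def IsUnbiased {Ω : Type*} [MeasurableSpace Ω] (P : Measure Ω) (T : Ω → ℝ) (θ : ℝ) : Prop :=
  Integrable T P ∧ ∫ ω, T ω ∂P = θ

end

end GroupLasso

open GroupLasso

/-!
The group Lasso objective is the sum of a squared distance `½‖y - X β‖²`, strictly convex because
`X` is injective, and of a convex penalty. A minimizer is characterized by a variational
inequality (`isPenalizedMin_iff`); it gives existence and uniqueness, shows that `y ↦ X β̂(y)` is
`1`-Lipschitz and `y ↦ β̂(y)` continuous, and amounts to the optimality conditions block by block
(`IsSolution.optimality`).

*Smoothness.* If `y` is not in the transition set, `‖X_bᵀ (y - X β̂(y))‖ < λ` for the blocks `b`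
outside the block support `I` of `β̂(y)`. By continuity these blocks stay inactive and those of `I`
stay active near `y` (`eventually_blockVec_solution`), so that `u = β̂_I` solves the equation
`Φ(u) = X_Iᵀ X_I u + λ (u_b / ‖u_b‖)_b = X_Iᵀ y`. The derivative of `Φ` is
`X_Iᵀ X_I + λ δ ∘ P`, a positive definite matrix plus a positive semidefinite one, so the inverse
function theorem yields `μ̂ = X_I Φ⁻¹(X_Iᵀ ·)` near `y`, and the divergence by the chain rule
(`prediction_smooth`).

*The transition set is null.* A point of `H_{I,b}` lies in the set where the minimizer `β` among
the vectors supported on `I` satisfies `‖X_bᵀ (y - X β)‖ = λ`. This set is closed, because `β`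
depends continuously on `y`. There is a direction `u` with `X_Iᵀ u = 0` and `X_bᵀ u ≠ 0`; along it
`β` is constant, so the equation says that the points of a line lie on a sphere, which happens
finitely often, and Fubini's theorem applies (`volume_transitionPiece`).

*Degrees of freedom.* A Lipschitz function satisfies Stein's identity
`E[∂_v f(ε)] σ² = E[f(ε) ⟪v, ε⟫]` (`integral_lineDeriv_multivariateGaussian`): translate the
Gaussian density instead of the function and differentiate under the integral. Summed over the
coordinates of `μ̂` it gives the formula for the mean of the divergence.
-/

namespace GroupLasso

open scoped RealInnerProductSpace
open Filter Topology

/-! ### Penalized least squares -/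

section

section PenalizedLeastSquares

variable {E F : Type*} [NormedAddCommGroup E] [NormedSpace ℝ E]
  [NormedAddCommGroup F] [InnerProductSpace ℝ F]

/-- `x` minimizes the penalized least squares objective `½‖y - A x‖² + g x`. -/
def IsPenalizedMin (A : E →ₗ[ℝ] F) (g : E → ℝ) (y : F) (x : E) : Prop :=
  ∀ x', 1 / 2 * ‖y - A x‖ ^ 2 + g x ≤ 1 / 2 * ‖y - A x'‖ ^ 2 + g x'

variable {A : E →ₗ[ℝ] F} {g : E → ℝ}

lemma half_sq_residual_expand (A : E →ₗ[ℝ] F) (y : F) (x x' : E) :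
    1 / 2 * ‖y - A x'‖ ^ 2
      = 1 / 2 * ‖y - A x‖ ^ 2 - ⟪y - A x, A (x' - x)⟫ + 1 / 2 * ‖A (x' - x)‖ ^ 2 := by
  have h : y - A x' = (y - A x) - A (x' - x) := by rw [map_sub]; abel
  rw [h, norm_sub_sq_real]
  ring

/-- Minimality is equivalent to `Aᵀ (y - A x)` being a subgradient of `g` at `x`. -/
lemma isPenalizedMin_iff (hg : ConvexOn ℝ Set.univ g) (y : F) (x : E) :
    IsPenalizedMin A g y x ↔ ∀ x', g x + ⟪y - A x, A (x' - x)⟫ ≤ g x' := by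
  constructor
  · intro h x'
    -- Compare `x` with `x + t (x' - x)` and let `t` tend to `0`.
    have key : ∀ t ∈ Set.Ioc (0 : ℝ) 1,
        g x + ⟪y - A x, A (x' - x)⟫ ≤ g x' + t * (1 / 2 * ‖A (x' - x)‖ ^ 2) := by
      intro t ht
      have h1 := h (x + t • (x' - x))
      rw [half_sq_residual_expand A y x (x + _), add_sub_cancel_left, map_smul, inner_smul_right,
        norm_smul, Real.norm_eq_abs, mul_pow, sq_abs] at h1
      have h2 := hg.2 (Set.mem_univ x) (Set.mem_univ x') (sub_nonneg.2 ht.2) ht.1.le (by ring)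
      have h3 : (1 - t) • x + t • x' = x + t • (x' - x) := by module
      rw [h3, smul_eq_mul, smul_eq_mul] at h2
      have h4 : t * (g x + ⟪y - A x, A (x' - x)⟫)
          ≤ t * (g x' + t * (1 / 2 * ‖A (x' - x)‖ ^ 2)) := by linarith
      exact le_of_mul_le_mul_left h4 ht.1
    have hlim : Tendsto (fun t : ℝ => g x' + t * (1 / 2 * ‖A (x' - x)‖ ^ 2)) (𝓝[>] 0)
        (𝓝 (g x' + 0 * (1 / 2 * ‖A (x' - x)‖ ^ 2))) :=
      (Continuous.tendsto (by fun_prop) 0).mono_left nhdsWithin_le_nhds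
    rw [zero_mul, add_zero] at hlim
    refine ge_of_tendsto hlim ?_
    filter_upwards [Ioc_mem_nhdsGT (zero_lt_one' ℝ)] with t ht using key t ht
  · intro h x'
    rw [half_sq_residual_expand A y x x']
    nlinarith [h x', sq_nonneg ‖A (x' - x)‖]

/-- The fitted values of two penalized minimizers satisfy the firm nonexpansiveness inequality. -/
lemma IsPenalizedMin.sq_norm_sub_le (hg : ConvexOn ℝ Set.univ g) {y₁ y₂ : F} {x₁ x₂ : E}
    (h₁ : IsPenalizedMin A g y₁ x₁) (h₂ : IsPenalizedMin A g y₂ x₂) :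
    ‖A x₁ - A x₂‖ ^ 2 ≤ ⟪y₁ - y₂, A x₁ - A x₂⟫ := by
  have a := (isPenalizedMin_iff hg _ _).1 h₁ x₂
  have b := (isPenalizedMin_iff hg _ _).1 h₂ x₁
  rw [map_sub] at a b
  rw [← real_inner_self_eq_norm_sq]
  simp only [inner_sub_left, inner_sub_right] at a b ⊢
  linarith

lemma IsPenalizedMin.norm_sub_le (hg : ConvexOn ℝ Set.univ g) {y₁ y₂ : F} {x₁ x₂ : E}
    (h₁ : IsPenalizedMin A g y₁ x₁) (h₂ : IsPenalizedMin A g y₂ x₂) :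
    ‖A x₁ - A x₂‖ ≤ ‖y₁ - y₂‖ := by
  have h := (h₁.sq_norm_sub_le hg h₂).trans (real_inner_le_norm _ _)
  rcases (norm_nonneg (A x₁ - A x₂)).eq_or_lt with h0 | h0
  · rw [← h0]; exact norm_nonneg _
  · rw [sq] at h
    exact le_of_mul_le_mul_right h h0

lemma IsPenalizedMin.unique (hA : Function.Injective A) (hg : ConvexOn ℝ Set.univ g) {y : F}
    {x₁ x₂ : E} (h₁ : IsPenalizedMin A g y x₁) (h₂ : IsPenalizedMin A g y x₂) : x₁ = x₂ := by
  have h := h₁.norm_sub_le hg h₂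
  rw [sub_self, norm_zero] at h
  exact hA (sub_eq_zero.1 (norm_le_zero_iff.1 h))

/-- The objective is coercive because `A` is injective and `g` is bounded below. -/
lemma exists_isPenalizedMin [FiniteDimensional ℝ E] (hA : Function.Injective A)
    (hg : Continuous g) (hg0 : ∀ x, 0 ≤ g x) (y : F) : ∃ x, IsPenalizedMin A g y x := by
  have hAc : Continuous A := A.continuous_of_finiteDimensional
  have : ProperSpace E := FiniteDimensional.proper ℝ E
  refine Continuous.exists_forall_le (f := fun x => 1 / 2 * ‖y - A x‖ ^ 2 + g x) (by fun_prop) ?_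
  obtain ⟨K, hK, hKA⟩ := A.exists_antilipschitzWith (LinearMap.ker_eq_bot.2 hA)
  have h1 : Tendsto (fun x => ‖A x‖) (cocompact E) atTop := by
    have := hKA.tendsto_cobounded
    rw [Metric.cobounded_eq_cocompact] at this
    exact tendsto_norm_cobounded_atTop.comp this
  have h2 : Tendsto (fun x => ‖y - A x‖) (cocompact E) atTop := by
    refine tendsto_atTop_mono (fun x => ?_) (tendsto_atTop_add_const_right _ (-‖y‖) h1)
    have := norm_sub_norm_le (A x) y
    rw [norm_sub_rev] at this
    linarith
  refine tendsto_atTop_mono (fun x => ?_)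
    (((tendsto_pow_atTop two_ne_zero).comp h2).const_mul_atTop (show (0 : ℝ) < 1 / 2 by norm_num))
  simpa using hg0 x

/-- A choice of penalized minimizers depends continuously on the data. -/
lemma continuous_of_isPenalizedMin [FiniteDimensional ℝ E] (hA : Function.Injective A)
    (hg : ConvexOn ℝ Set.univ g) {s : F → E} (hs : ∀ y, IsPenalizedMin A g y (s y)) :
    Continuous s := by
  obtain ⟨K, hK, hKA⟩ := A.exists_antilipschitzWith (LinearMap.ker_eq_bot.2 hA)
  refine LipschitzWith.continuous (K := K) (LipschitzWith.of_dist_le_mul fun y₁ y₂ => ?_)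
  refine (hKA.le_mul_dist _ _).trans ?_
  gcongr
  rw [dist_eq_norm, dist_eq_norm]
  exact (hs y₁).norm_sub_le hg (hs y₂)

end PenalizedLeastSquares

/-- The subgradients of `lam * ‖·‖` at `w` have norm at most `lam`, and `(lam / ‖w‖) • w` is the
only one if `w ≠ 0`. -/
lemma subgradient_norm {V : Type*} [NormedAddCommGroup V] [InnerProductSpace ℝ V] {lam : ℝ}
    (hlam : 0 < lam) {z w : V} (h : ∀ w', lam * ‖w‖ + ⟪z, w' - w⟫ ≤ lam * ‖w'‖) :
    ‖z‖ ≤ lam ∧ (w ≠ 0 → z = (lam / ‖w‖) • w) := by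
  have h1 : ‖z‖ ≤ lam := by
    by_contra! hlt
    have h2 := h (w + z)
    rw [add_sub_cancel_left, real_inner_self_eq_norm_sq] at h2
    have := norm_add_le w z
    nlinarith [norm_nonneg z]
  refine ⟨h1, fun hw => ?_⟩
  have hw' : 0 < ‖w‖ := norm_pos_iff.2 hw
  have h2 : lam * ‖w‖ ≤ ⟪z, w⟫ := by
    have := h 0
    rw [zero_sub, inner_neg_right, norm_zero] at this
    linarith
  -- The square expands to `‖z‖² - 2 (lam / ‖w‖) ⟪z, w⟫ + lam²`.
  have h3 : ‖z - (lam / ‖w‖) • w‖ ^ 2 ≤ 0 := by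
    rw [norm_sub_sq_real, inner_smul_right, norm_smul, Real.norm_of_nonneg (by positivity),
      div_mul_cancel₀ _ hw'.ne']
    have h4 : lam * lam ≤ lam / ‖w‖ * ⟪z, w⟫ := by
      rw [div_mul_eq_mul_div, le_div_iff₀ hw']
      nlinarith
    nlinarith [norm_nonneg z]
  exact sub_eq_zero.1 (norm_eq_zero.1 (pow_eq_zero_iff two_ne_zero |>.1
    (le_antisymm h3 (sq_nonneg _))))

lemma norm_subgradient_ineq {V : Type*} [NormedAddCommGroup V] [InnerProductSpace ℝ V] {lam : ℝ}
    (hlam : 0 < lam) {w : V} (hw : w ≠ 0) (w' : V) :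
    lam * ‖w‖ + ⟪(lam / ‖w‖) • w, w' - w⟫ ≤ lam * ‖w'‖ := by
  have hw' : 0 < ‖w‖ := norm_pos_iff.2 hw
  rw [real_inner_smul_left, inner_sub_right, real_inner_self_eq_norm_sq]
  have := real_inner_le_norm w w'
  have h2 : lam / ‖w‖ * ⟪w, w'⟫ ≤ lam / ‖w‖ * (‖w‖ * ‖w'‖) := by gcongr
  have h3 : lam / ‖w‖ * (‖w‖ * ‖w'‖) = lam * ‖w'‖ := by field_simp
  have h4 : lam / ‖w‖ * ‖w‖ ^ 2 = lam * ‖w‖ := by field_simp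
  linarith

end

/-! ### Optimality conditions along the blocks -/

section

variable {Q N : ℕ}

/-- The map `β ↦ X β` between Euclidean spaces. -/
noncomputable def design (X : Matrix (Fin Q) (Fin N) ℝ) :
    EuclideanSpace ℝ (Fin N) →ₗ[ℝ] EuclideanSpace ℝ (Fin Q) where
  toFun β := WithLp.toLp 2 (X *ᵥ ⇑β)
  map_add' v w := by ext i; simp [Matrix.mulVec_add]
  map_smul' c v := by ext i; simp [Matrix.mulVec_smul]

lemma design_injective {X : Matrix (Fin Q) (Fin N) ℝ} (hX : LinearIndependent ℝ X.col) :
    Function.Injective (design X) := by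
  intro v w h
  have h' : X *ᵥ ⇑v = X *ᵥ ⇑w := congrArg WithLp.ofLp h
  exact WithLp.ofLp_injective 2 (Matrix.mulVec_injective_iff.2 hX h')

/-- The linear map `β ↦ β_b`. -/
noncomputable def blockLin (b : Finset (Fin N)) :
    EuclideanSpace ℝ (Fin N) →ₗ[ℝ] EuclideanSpace ℝ b where
  toFun β := blockVec β b
  map_add' v w := by ext i; simp [blockVec]
  map_smul' c v := by ext i; simp [blockVec]

/-- The vector `X_bᵀ r`. -/
noncomputable def blockGrad (X : Matrix (Fin Q) (Fin N) ℝ) (b : Finset (Fin N))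
    (r : EuclideanSpace ℝ (Fin Q)) : EuclideanSpace ℝ b :=
  WithLp.toLp 2 ((cols X b)ᵀ *ᵥ ⇑r)

lemma blockGrad_add_smul (X : Matrix (Fin Q) (Fin N) ℝ) (b : Finset (Fin N))
    (r u : EuclideanSpace ℝ (Fin Q)) (t : ℝ) :
    blockGrad X b (r + t • u) = blockGrad X b r + t • blockGrad X b u := by
  ext i
  simp [blockGrad, Matrix.mulVec_add, Matrix.mulVec_smul]

lemma continuous_blockGrad (X : Matrix (Fin Q) (Fin N) ℝ) (b : Finset (Fin N)) :
    Continuous (blockGrad X b) := by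
  unfold blockGrad
  fun_prop

lemma continuous_blockVec (b : Finset (Fin N)) :
    Continuous fun β : EuclideanSpace ℝ (Fin N) => blockVec β b :=
  (blockLin b).continuous_of_finiteDimensional

lemma sum_parts (B : Finpartition (Finset.univ : Finset (Fin N))) (f : Fin N → ℝ) :
    ∑ i, f i = ∑ b ∈ B.parts, ∑ i : b, f i := by
  have h := Finset.sum_biUnion (f := f) B.disjoint
  rw [B.biUnion_parts] at h
  rw [h]
  exact Finset.sum_congr rfl fun b _ => (Finset.sum_coe_sort b f).symm

lemma inner_design_eq (X : Matrix (Fin Q) (Fin N) ℝ) (r : EuclideanSpace ℝ (Fin Q))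
    (v : EuclideanSpace ℝ (Fin N)) :
    ⟪r, design X v⟫ = ∑ i, (∑ k, X k i * r k) * v i := by
  simp only [design, LinearMap.coe_mk, AddHom.coe_mk, PiLp.inner_apply, Matrix.mulVec, dotProduct,
    RCLike.inner_apply, conj_trivial, Finset.sum_mul]
  rw [Finset.sum_comm]
  exact Finset.sum_congr rfl fun i _ => Finset.sum_congr rfl fun k _ => by ring

/-- The inner product `⟪r, X v⟫ = ∑ b, ⟪X_bᵀ r, v_b⟫` splits along the blocks. -/
lemma inner_design (X : Matrix (Fin Q) (Fin N) ℝ)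
    (B : Finpartition (Finset.univ : Finset (Fin N))) (r : EuclideanSpace ℝ (Fin Q))
    (v : EuclideanSpace ℝ (Fin N)) :
    ⟪r, design X v⟫ = ∑ b ∈ B.parts, ⟪blockGrad X b r, blockVec v b⟫ := by
  rw [inner_design_eq, sum_parts B]
  refine Finset.sum_congr rfl fun b _ => ?_
  simp only [blockGrad, blockVec, PiLp.inner_apply, RCLike.inner_apply, conj_trivial,
    Matrix.mulVec, dotProduct, cols, Matrix.transpose_apply, Matrix.submatrix_apply, id]
  exact Finset.sum_congr rfl fun i _ => mul_comm _ _

/-- The group Lasso penalty. -/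
noncomputable def penalty (B : Finpartition (Finset.univ : Finset (Fin N))) (lam : ℝ)
    (β : EuclideanSpace ℝ (Fin N)) : ℝ :=
  lam * ∑ b ∈ B.parts, ‖blockVec β b‖

section

variable (B : Finpartition (Finset.univ : Finset (Fin N))) {lam : ℝ}

lemma convexOn_penalty (hlam : 0 < lam) : ConvexOn ℝ Set.univ (penalty B lam) := by
  refine ⟨convex_univ, fun v _ w _ s t hs ht _ => ?_⟩
  simp only [penalty, smul_eq_mul]
  have h : ∀ b ∈ B.parts, ‖blockVec ⇑(s • v + t • w) b‖
      ≤ s * ‖blockVec v b‖ + t * ‖blockVec w b‖ := by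
    intro b _
    have : blockVec ⇑(s • v + t • w) b = s • blockVec v b + t • blockVec w b := by
      ext i; simp [blockVec]
    rw [this]
    refine (norm_add_le _ _).trans_eq ?_
    rw [norm_smul, norm_smul, Real.norm_of_nonneg hs, Real.norm_of_nonneg ht]
  refine (mul_le_mul_of_nonneg_left (Finset.sum_le_sum h) hlam.le).trans_eq ?_
  rw [Finset.sum_add_distrib, ← Finset.mul_sum, ← Finset.mul_sum]
  ring

lemma continuous_penalty : Continuous (penalty B lam) := by
  unfold penalty
  exact continuous_const.mul (continuous_finsetSum _ fun b _ => (continuous_blockVec b).norm)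

lemma penalty_nonneg (hlam : 0 < lam) (β : EuclideanSpace ℝ (Fin N)) : 0 ≤ penalty B lam β :=
  mul_nonneg hlam.le (Finset.sum_nonneg fun _ _ => norm_nonneg _)

variable {X : Matrix (Fin Q) (Fin N) ℝ}

lemma isSolution_solution (hX : LinearIndependent ℝ X.col) (hlam : 0 < lam)
    (y : EuclideanSpace ℝ (Fin Q)) : IsSolution X B lam y (solution X B lam y) :=
  Classical.epsilon_spec (p := IsSolution X B lam y) (exists_isPenalizedMin (design_injective hX)
    (continuous_penalty B) (penalty_nonneg B hlam) y)

lemma eq_solution (hX : LinearIndependent ℝ X.col) (hlam : 0 < lam)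
    {y : EuclideanSpace ℝ (Fin Q)} {β : EuclideanSpace ℝ (Fin N)} (h : IsSolution X B lam y β) :
    β = solution X B lam y :=
  IsPenalizedMin.unique (A := design X) (design_injective hX) (convexOn_penalty B hlam) h
    (isSolution_solution B hX hlam y)

lemma continuous_solution (hX : LinearIndependent ℝ X.col) (hlam : 0 < lam) :
    Continuous (solution X B lam) :=
  continuous_of_isPenalizedMin (A := design X) (design_injective hX) (convexOn_penalty B hlam)
    fun y => isSolution_solution B hX hlam y

lemma lipschitzWith_prediction (hX : LinearIndependent ℝ X.col) (hlam : 0 < lam) :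
    LipschitzWith 1 (prediction X B lam) := by
  refine LipschitzWith.of_dist_le_mul fun y₁ y₂ => ?_
  rw [NNReal.coe_one, one_mul, dist_eq_norm, dist_eq_norm]
  exact IsPenalizedMin.norm_sub_le (A := design X) (convexOn_penalty B hlam)
    (isSolution_solution B hX hlam y₁) (isSolution_solution B hX hlam y₂)

/-- Two blocks of a partition that share an index coincide. -/
lemma eq_of_mem_parts {b c : Finset (Fin N)} (hb : b ∈ B.parts) (hc : c ∈ B.parts) {i : Fin N}
    (hib : i ∈ b) (hic : i ∈ c) : b = c := by
  by_contra hne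
  exact Finset.disjoint_left.1 (B.disjoint hb hc hne) hib hic

/-- First order optimality conditions for the group Lasso, block by block. -/
lemma IsSolution.optimality (hlam : 0 < lam) {y : EuclideanSpace ℝ (Fin Q)}
    {β : EuclideanSpace ℝ (Fin N)} (h : IsSolution X B lam y β) {b : Finset (Fin N)}
    (hb : b ∈ B.parts) :
    ‖blockGrad X b (y - design X β)‖ ≤ lam ∧
      (blockVec β b ≠ 0 →
        blockGrad X b (y - design X β) = (lam / ‖blockVec β b‖) • blockVec β b) := by
  refine subgradient_norm hlam fun w' => ?_
  -- Test the variational inequality with a perturbation of `β` in the block `b` alone.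
  set v : EuclideanSpace ℝ (Fin N) := WithLp.toLp 2 (extend (⇑(w' - blockVec β b))) with hv
  have hvb : blockVec v b = w' - blockVec β b := by
    ext i; simp [hv, blockVec, extend]
  have hvc : ∀ c ∈ B.parts, c ≠ b → blockVec v c = 0 := by
    intro c hc hne
    ext i
    have : (i : Fin N) ∉ b := fun hib => hne (eq_of_mem_parts B hc hb i.2 hib)
    simp [hv, blockVec, extend, this]
  have key := (isPenalizedMin_iff (A := design X) (convexOn_penalty B hlam) y β).1 h (β + v)
  have hsum : ∀ c, blockVec ⇑(β + v) c = blockVec β c + blockVec v c := fun c => by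
    ext i; simp [blockVec]
  rw [add_sub_cancel_left, inner_design X B, penalty, penalty, ← Finset.add_sum_erase _ _ hb,
    ← Finset.add_sum_erase _ (fun c => ‖blockVec ⇑(β + v) c‖) hb,
    ← Finset.add_sum_erase _ (fun c => ⟪_, blockVec v c⟫) hb] at key
  have e1 : ∑ c ∈ B.parts.erase b, ‖blockVec ⇑(β + v) c‖
      = ∑ c ∈ B.parts.erase b, ‖blockVec β c‖ :=
    Finset.sum_congr rfl fun c hc => by
      rw [hsum, hvc c (Finset.mem_of_mem_erase hc) (Finset.ne_of_mem_erase hc), add_zero]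
  have e2 : ∑ c ∈ B.parts.erase b, ⟪blockGrad X c (y - design X β), blockVec v c⟫ = 0 :=
    Finset.sum_eq_zero fun c hc => by
      rw [hvc c (Finset.mem_of_mem_erase hc) (Finset.ne_of_mem_erase hc), inner_zero_right]
  rw [e1, e2, hsum b, hvb, add_sub_cancel] at key
  linarith

lemma mem_bsupp_iff {β : EuclideanSpace ℝ (Fin N)} {b : Finset (Fin N)} :
    b ∈ bsupp B β ↔ b ∈ B.parts ∧ blockVec β b ≠ 0 := by
  simp [bsupp]

lemma blockVec_eq_zero_of_notMem_bsupp {β : EuclideanSpace ℝ (Fin N)} {b : Finset (Fin N)}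
    (hb : b ∈ B.parts) (h : b ∉ bsupp B β) : blockVec β b = 0 := by
  by_contra h0
  exact h ((mem_bsupp_iff B).2 ⟨hb, h0⟩)

lemma apply_eq_zero_of_blockVec_eq_zero {β : EuclideanSpace ℝ (Fin N)} {b : Finset (Fin N)}
    (h : blockVec β b = 0) {i : Fin N} (hi : i ∈ b) : β i = 0 :=
  congrArg (fun w : EuclideanSpace ℝ b => w ⟨i, hi⟩) h

lemma mem_indices_iff {I : Finset (Finset (Fin N))} (hI : I ⊆ B.parts) (i : Fin N) :
    i ∈ indices I ↔ B.part i ∈ I := by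
  simp only [indices, Finset.mem_biUnion, id]
  constructor
  · rintro ⟨b, hb, hib⟩
    rwa [B.part_eq_of_mem (hI hb) hib]
  · exact fun h => ⟨_, h, B.mem_part (Finset.mem_univ _)⟩

/-- If `β` vanishes off `J`, then `X_J β_J = X β`. -/
lemma cols_mulVec_blockVec {J : Finset (Fin N)} {β : EuclideanSpace ℝ (Fin N)}
    (h : ∀ i ∉ J, β i = 0) : cols X J *ᵥ ⇑(blockVec β J) = X *ᵥ ⇑β := by
  funext k
  simp only [Matrix.mulVec, dotProduct, cols, blockVec, Matrix.submatrix_apply, id]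
  rw [Finset.sum_coe_sort J (fun i => X k i * β i)]
  exact Finset.sum_subset (Finset.subset_univ J) fun i _ hi => by rw [h i hi, mul_zero]

lemma residual_eq {I : Finset (Finset (Fin N))} (hI : I ⊆ B.parts) {β : EuclideanSpace ℝ (Fin N)}
    (h : ∀ b ∈ B.parts, b ∉ I → blockVec β b = 0) (y : EuclideanSpace ℝ (Fin Q)) :
    residual X I y β = y - design X β := by
  have h0 : ∀ i ∉ indices I, β i = 0 := fun i hi =>
    apply_eq_zero_of_blockVec_eq_zero (h _ (B.part_mem.2 (Finset.mem_univ i))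
      fun h' => hi ((mem_indices_iff B hI i).2 h')) (B.mem_part (Finset.mem_univ i))
  rw [residual, cols_mulVec_blockVec h0]
  rfl

end

end

/-! ### The transition set is null -/

section

variable {Q N : ℕ} {X : Matrix (Fin Q) (Fin N) ℝ}
  (B : Finpartition (Finset.univ : Finset (Fin N))) {lam : ℝ}

/-- A closed set is null if every line in a fixed direction meets it in a finite set. -/
lemma volume_eq_zero_of_finite_lines {S : Set (EuclideanSpace ℝ (Fin Q))} (hS : IsClosed S)
    (u : EuclideanSpace ℝ (Fin Q)) (h : ∀ y, {t : ℝ | y + t • u ∈ S}.Finite) :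
    volume S = 0 := by
  have := ae_mem_of_ae_add_linearMap_mem ((1 : ℝ →ₗ[ℝ] ℝ).smulRight u) volume volume
    hS.measurableSet.compl fun y => by
      rw [ae_iff]
      refine (Set.Finite.subset (h y) fun t ht => ?_).measure_zero _
      simpa using ht
  simpa [ae_iff] using this

/-- A line meets a sphere in finitely many points. -/
lemma finite_norm_add_smul_eq {V : Type*} [NormedAddCommGroup V] [InnerProductSpace ℝ V]
    (z : V) {w : V} (hw : w ≠ 0) (c : ℝ) : {t : ℝ | ‖z + t • w‖ = c}.Finite := by
  open Polynomial in
  set p : ℝ[X] := C (‖w‖ ^ 2) * X ^ 2 + C (2 * ⟪z, w⟫) * X + C (‖z‖ ^ 2 - c ^ 2) with hp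
  have hp0 : p ≠ 0 := by
    intro h0
    have h2 : p.coeff 2 = ‖w‖ ^ 2 := by
      rw [hp]
      simp only [Polynomial.coeff_add, Polynomial.coeff_C_mul, Polynomial.coeff_X_pow,
        Polynomial.coeff_X, Polynomial.coeff_C]
      norm_num
    rw [h0, Polynomial.coeff_zero] at h2
    exact hw (norm_eq_zero.1 (pow_eq_zero_iff two_ne_zero |>.1 h2.symm))
  refine (Polynomial.finite_setOfPred_isRoot hp0).subset fun t (ht : _ = c) => ?_
  have h := norm_add_sq_real z (t • w)
  rw [ht, inner_smul_right, norm_smul, mul_pow, Real.norm_eq_abs, sq_abs] at h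
  simp only [Set.mem_ofPred_eq, Polynomial.IsRoot.def, hp, Polynomial.eval_add,
    Polynomial.eval_mul, Polynomial.eval_C, Polynomial.eval_pow, Polynomial.eval_X]
  linarith

/-- Since the columns of `X` are independent, there is a vector orthogonal to all of them but
the `j`-th. -/
lemma exists_dual_column (hX : LinearIndependent ℝ X.col) (j : Fin N) :
    ∃ u : EuclideanSpace ℝ (Fin Q), ∀ v, ⟪u, design X v⟫ = v j := by
  obtain ⟨L, hL⟩ := (design X).exists_leftInverse_of_injective
    (LinearMap.ker_eq_bot.2 (design_injective hX))
  refine ⟨L.adjoint (EuclideanSpace.single j 1), fun v => ?_⟩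
  rw [LinearMap.adjoint_inner_left, ← LinearMap.comp_apply, hL, EuclideanSpace.inner_single_left]
  simp

/-- The vectors whose block support is contained in `I`. -/
noncomputable def supportedOn (I : Finset (Finset (Fin N))) :
    Submodule ℝ (EuclideanSpace ℝ (Fin N)) where
  carrier := {β | ∀ b ∈ B.parts, b ∉ I → blockVec β b = 0}
  add_mem' {v w} hv hw b hb hbI := by
    change blockLin b (v + w) = 0
    rw [map_add]
    change blockVec v b + blockVec w b = 0
    rw [hv b hb hbI, hw b hb hbI, add_zero]
  zero_mem' b _ _ := (blockLin b).map_zero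
  smul_mem' c v hv b hb hbI := by
    change blockLin b (c • v) = 0
    rw [map_smul]
    change c • blockVec v b = 0
    rw [hv b hb hbI, smul_zero]

/-- The minimizers of the group Lasso objective among the vectors supported on `I`. -/
def IsRestrictedSolution (X : Matrix (Fin Q) (Fin N) ℝ)
    (B : Finpartition (Finset.univ : Finset (Fin N))) (lam : ℝ) (I : Finset (Finset (Fin N)))
    (y : EuclideanSpace ℝ (Fin Q)) (β : supportedOn B I) : Prop :=
  IsPenalizedMin (design X ∘ₗ (supportedOn B I).subtype)
    (penalty B lam ∘ (supportedOn B I).subtype) y β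

section

variable (I : Finset (Finset (Fin N)))

lemma restricted_injective (hX : LinearIndependent ℝ X.col) :
    Function.Injective (design X ∘ₗ (supportedOn B I).subtype) :=
  (design_injective hX).comp Subtype.val_injective

lemma convexOn_restricted_penalty (hlam : 0 < lam) :
    ConvexOn ℝ Set.univ (penalty B lam ∘ (supportedOn B I).subtype) :=
  (convexOn_penalty B hlam).comp_linearMap _

lemma exists_isRestrictedSolution (hX : LinearIndependent ℝ X.col) (hlam : 0 < lam)
    (y : EuclideanSpace ℝ (Fin Q)) : ∃ β, IsRestrictedSolution X B lam I y β :=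
  exists_isPenalizedMin (restricted_injective B I hX)
    ((continuous_penalty B).comp continuous_subtype_val) (fun β => penalty_nonneg B hlam β) y

variable {I}

/-- The restricted solution is unchanged when `y` moves orthogonally to the columns of `X_I`. -/
lemma IsRestrictedSolution.add_smul (hlam : 0 < lam) {y u : EuclideanSpace ℝ (Fin Q)}
    (hu : ∀ v ∈ supportedOn B I, ⟪u, design X v⟫ = 0) {β : supportedOn B I}
    (h : IsRestrictedSolution X B lam I y β) (t : ℝ) :
    IsRestrictedSolution X B lam I (y + t • u) β := by
  have hc := convexOn_restricted_penalty B I hlam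
  refine (isPenalizedMin_iff hc _ _).2 fun β' => ?_
  have h1 := (isPenalizedMin_iff hc _ _).1 h β'
  rw [add_sub_right_comm, inner_add_left, inner_smul_left]
  have h2 : ⟪u, (design X ∘ₗ (supportedOn B I).subtype) (β' - β)⟫ = 0 := hu _ (β' - β).2
  rw [h2, mul_zero, add_zero]
  exact h1

/-- The stationarity conditions on the blocks of `I` suffice for the restricted problem. -/
lemma isRestrictedSolution_of_stationary (hlam : 0 < lam)
    {y : EuclideanSpace ℝ (Fin Q)} {β : EuclideanSpace ℝ (Fin N)} (hβ : bsupp B β = I)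
    (hmem : β ∈ supportedOn B I)
    (h : ∀ c ∈ I, blockGrad X c (y - design X β) = (lam / ‖blockVec β c‖) • blockVec β c) :
    IsRestrictedSolution X B lam I y ⟨β, hmem⟩ := by
  refine (isPenalizedMin_iff (convexOn_restricted_penalty B I hlam) _ _).2 fun β' => ?_
  change penalty B lam β + ⟪y - design X β, design X ((β' : EuclideanSpace ℝ (Fin N)) - β)⟫
    ≤ penalty B lam β'
  rw [inner_design X B, penalty, penalty, Finset.mul_sum, Finset.mul_sum,
    ← Finset.sum_add_distrib]
  refine Finset.sum_le_sum fun c hc => ?_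
  have hsub : blockVec ⇑((β' : EuclideanSpace ℝ (Fin N)) - β) c
      = blockVec β' c - blockVec β c := (blockLin c).map_sub _ _
  rw [hsub]
  by_cases hcI : c ∈ I
  · rw [h c hcI]
    exact norm_subgradient_ineq hlam ((mem_bsupp_iff B).1 (hβ ▸ hcI)).2 _
  · rw [hmem c hc hcI, β'.2 c hc hcI]
    simp

/-- On `H_{I,b}` the restricted solution `β` satisfies `‖X_bᵀ (y - X β)‖ = λ`. This relation
defines a closed set, and it has finitely many solutions on each line whose direction is orthogonal
to the columns of `X_I` but not to those of `X_b`. -/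
lemma volume_transitionPiece (hX : LinearIndependent ℝ X.col) (hlam : 0 < lam)
    (hI : I ⊆ B.parts) {b : Finset (Fin N)} (hb : b ∈ B.parts) (hbI : b ∉ I) :
    volume (transitionPiece X B lam I b) = 0 := by
  choose s hs using exists_isRestrictedSolution (X := X) B I hX hlam
  have hs_cont : Continuous s := continuous_of_isPenalizedMin (restricted_injective B I hX)
    (convexOn_restricted_penalty B I hlam) hs
  have hs_eq : ∀ {y β}, IsRestrictedSolution X B lam I y β → s y = β := fun h =>
    IsPenalizedMin.unique (restricted_injective B I hX) (convexOn_restricted_penalty B I hlam)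
      (hs _) h
  set S : Set (EuclideanSpace ℝ (Fin Q)) :=
    {y | ‖blockGrad X b (y - design X (s y))‖ = lam} with hS_def
  have hdes : Continuous (design X) := (design X).continuous_of_finiteDimensional
  have hS : IsClosed S := isClosed_eq ((continuous_blockGrad X b).comp (continuous_id.sub
    (hdes.comp (continuous_subtype_val.comp hs_cont)))).norm continuous_const
  have hsub : transitionPiece X B lam I b ⊆ S := by
    rintro y ⟨β, hβ, h1, h2⟩
    have hmem : β ∈ supportedOn B I := fun c hc hcI =>
      blockVec_eq_zero_of_notMem_bsupp B hc (hβ.symm ▸ hcI)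
    rw [residual_eq B hI hmem] at h1
    have hsol : IsRestrictedSolution X B lam I y ⟨β, hmem⟩ :=
      isRestrictedSolution_of_stationary B hlam hβ hmem fun c hc => by
        have := h2 c hc
        rwa [residual_eq B hI hmem] at this
    rw [hS_def, Set.mem_ofPred_eq, hs_eq hsol]
    exact h1
  obtain ⟨j, hj⟩ := B.nonempty_of_mem_parts hb
  obtain ⟨u, hu⟩ := exists_dual_column hX j
  have hu0 : ∀ v ∈ supportedOn B I, ⟪u, design X v⟫ = 0 := fun v hv => by
    rw [hu]
    exact apply_eq_zero_of_blockVec_eq_zero (hv b hb hbI) hj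
  have hub : blockGrad X b u ≠ 0 := by
    intro h0
    have h1 : (∑ k, X k j * u k) = 0 :=
      congrArg (fun w : EuclideanSpace ℝ b => w ⟨j, hj⟩) h0
    have h2 := hu (EuclideanSpace.single j 1)
    rw [inner_design_eq, Finset.sum_eq_single j (by simp +contextual) (by simp), h1] at h2
    simp at h2
  refine measure_mono_null hsub (volume_eq_zero_of_finite_lines hS u fun y => ?_)
  refine (finite_norm_add_smul_eq (blockGrad X b (y - design X (s y))) hub lam).subset
    fun t ht => ?_
  have hst : s (y + t • u) = s y := hs_eq ((hs y).add_smul B hlam hu0 t)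
  rw [Set.mem_ofPred_eq, hS_def, Set.mem_ofPred_eq, hst, add_sub_right_comm,
    blockGrad_add_smul] at ht
  exact ht

end

lemma volume_transitionSet (hX : LinearIndependent ℝ X.col) (hlam : 0 < lam) :
    volume (transitionSet X B lam) = 0 := by
  refine (measure_biUnion_null_iff (Finset.countable_toSet _)).2 fun I hI =>
    (measure_biUnion_null_iff (Finset.countable_toSet _)).2 fun b hb => ?_
  have hb := Finset.mem_sdiff.1 (Finset.mem_coe.1 hb)
  exact volume_transitionPiece B hX hlam (Finset.mem_powerset.1 hI) hb.1 hb.2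

end

/-! ### Smoothness off the transition set -/

section

/-- The derivative of `x ↦ x / ‖x‖` is `P_{x^⊥} / ‖x‖`. -/
lemma hasFDerivAt_normalize {V : Type*} [NormedAddCommGroup V] [InnerProductSpace ℝ V]
    {x : V} (hx : x ≠ 0) :
    HasFDerivAt (fun x : V => ‖x‖⁻¹ • x) (‖x‖⁻¹ • (Submodule.span ℝ {x})ᗮ.starProjection) x := by
  have hx' : ‖x‖ ≠ 0 := norm_ne_zero_iff.2 hx
  have h1 : HasFDerivAt (fun x : V => ‖x‖) (‖x‖⁻¹ • innerSL ℝ x) x := by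
    have h := (hasStrictFDerivAt_norm_sq x).hasFDerivAt.sqrt (pow_ne_zero 2 hx')
    simp only [Real.sqrt_sq (norm_nonneg _)] at h
    convert h using 1
    ext v
    simp
    field_simp
  have h2 := ((hasDerivAt_inv hx').comp_hasFDerivAt x h1).fun_smul (hasFDerivAt_id x)
  refine h2.congr_fderiv ?_
  ext v
  have hp : (Submodule.span ℝ {x})ᗮ.starProjection v = v - (⟪x, v⟫ / ‖x‖ ^ 2) • x := by
    rw [Submodule.starProjection_orthogonal_val, Submodule.starProjection_singleton]
    rfl
  change ‖x‖⁻¹ • v + (-(‖x‖ ^ 2)⁻¹ * (‖x‖⁻¹ * ⟪x, v⟫)) • x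
    = ‖x‖⁻¹ • (Submodule.span ℝ {x})ᗮ.starProjection v
  rw [hp, smul_sub, smul_smul, sub_eq_add_neg, ← neg_smul]
  congr 2
  field_simp

variable {Q N : ℕ} {X : Matrix (Fin Q) (Fin N) ℝ}
  (B : Finpartition (Finset.univ : Finset (Fin N))) {lam : ℝ} {J : Finset (Fin N)}

/-- The linear map that sends a vector on `J` to the block `b` of its extension by zero. -/
noncomputable def blockExt (J b : Finset (Fin N)) : (J → ℝ) →L[ℝ] EuclideanSpace ℝ b :=
  LinearMap.toContinuousLinearMap
    { toFun := fun u => blockVec (extend u) b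
      map_add' := fun v w => by
        ext i
        by_cases h : (i : Fin N) ∈ J <;> simp [blockVec, extend, h]
      map_smul' := fun c v => by
        ext i
        by_cases h : (i : Fin N) ∈ J <;> simp [blockVec, extend, h] }

lemma blockExt_apply (J b : Finset (Fin N)) (u : J → ℝ) :
    blockExt J b u = blockVec (extend u) b := rfl

/-- The left-hand side of the stationarity equation `X_Jᵀ X_J u + λ (u_b / ‖u_b‖)_b = X_Jᵀ y`. -/
noncomputable def stationarityMap (X : Matrix (Fin Q) (Fin N) ℝ)
    (B : Finpartition (Finset.univ : Finset (Fin N))) (lam : ℝ) (J : Finset (Fin N))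
    (u : J → ℝ) : J → ℝ := fun i =>
  (((cols X J)ᵀ * cols X J) *ᵥ u) i + lam * (‖blockExt J (B.part i) u‖⁻¹ •
    blockExt J (B.part i) u) ⟨i, B.mem_part (Finset.mem_univ _)⟩

/-- The matrix `X_Jᵀ X_J + λ δ_β ∘ P_β` on the vectors indexed by `J`. -/
noncomputable def blockHessian (X : Matrix (Fin Q) (Fin N) ℝ)
    (B : Finpartition (Finset.univ : Finset (Fin N))) (lam : ℝ) (β : EuclideanSpace ℝ (Fin N))
    (J : Finset (Fin N)) : Matrix J J ℝ :=
  (cols X J)ᵀ * cols X J + lam • LinearMap.toMatrix' (deltaOp B β J ∘ₗ projOp B β J)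

lemma blockHessian_mulVec (β : EuclideanSpace ℝ (Fin N)) (v : J → ℝ) (i : J) :
    (blockHessian X B lam β J *ᵥ v) i = (((cols X J)ᵀ * cols X J) *ᵥ v) i +
      lam * (‖blockVec β (B.part i)‖⁻¹ •
        (Submodule.span ℝ {blockVec β (B.part i)})ᗮ.starProjection
          (blockVec (extend v) (B.part i))) ⟨i, B.mem_part (Finset.mem_univ _)⟩ := by
  rw [blockHessian, Matrix.add_mulVec, Pi.add_apply, Matrix.smul_mulVec, LinearMap.toMatrix'_mulVec,
    Pi.smul_apply, smul_eq_mul, PiLp.smul_apply, smul_eq_mul, inv_mul_eq_div]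
  rfl

lemma contDiffAt_stationarityMap {u : J → ℝ} (hu : ∀ i : J, blockVec (extend u) (B.part i) ≠ 0) :
    ContDiffAt ℝ 1 (stationarityMap X B lam J) u := by
  refine contDiffAt_pi.2 fun i => ?_
  have h1 : ContDiffAt ℝ 1 (fun u => blockExt J (B.part i) u) u :=
    (blockExt J (B.part i)).contDiff.contDiffAt
  have h2 : ContDiffAt ℝ 1 (fun u => ‖blockExt J (B.part i) u‖⁻¹ • blockExt J (B.part i) u) u :=
    ((h1.norm ℝ (hu i)).inv (norm_ne_zero_iff.2 (hu i))).smul h1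
  have h3 : ContDiffAt ℝ 1 (fun u : J → ℝ => (((cols X J)ᵀ * cols X J) *ᵥ u) i) u :=
    ((LinearMap.proj i ∘ₗ Matrix.mulVecLin ((cols X J)ᵀ * cols X J)).toContinuousLinearMap
      ).contDiff.contDiffAt
  exact h3.add (contDiffAt_const.mul (((EuclideanSpace.proj (𝕜 := ℝ)
    (⟨i, B.mem_part (Finset.mem_univ _)⟩ : B.part i)).contDiff.contDiffAt).comp u h2))

lemma hasFDerivAt_stationarityMap {β : EuclideanSpace ℝ (Fin N)} {u : J → ℝ}
    (hu : ∀ i : J, blockVec (extend u) (B.part i) = blockVec β (B.part i))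
    (hβ : ∀ i : J, blockVec β (B.part i) ≠ 0) :
    HasFDerivAt (stationarityMap X B lam J)
      (Matrix.mulVecLin (blockHessian X B lam β J)).toContinuousLinearMap u := by
  refine hasFDerivAt_pi'.2 fun i => ?_
  have h1 : HasFDerivAt (fun u => blockExt J (B.part i) u) (blockExt J (B.part i)) u :=
    (blockExt J (B.part i)).hasFDerivAt
  have h2 := (hasFDerivAt_normalize (x := blockExt J (B.part i) u)
    (by rw [blockExt_apply, hu]; exact hβ i)).comp u h1
  have h3 := ((LinearMap.proj i ∘ₗ
    Matrix.mulVecLin ((cols X J)ᵀ * cols X J)).toContinuousLinearMap).hasFDerivAt (x := u)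
  have h4 := h3.add (((EuclideanSpace.proj (𝕜 := ℝ)
    (⟨i, B.mem_part (Finset.mem_univ _)⟩ : B.part i)).hasFDerivAt.comp u h2).const_mul lam)
  refine h4.congr_fderiv ?_
  ext1 v
  refine Eq.trans ?_ (blockHessian_mulVec B β v i).symm
  rw [← hu i]
  rfl

lemma sum_extend_mul (v : J → ℝ) (h : Fin N → ℝ) :
    ∑ i : J, v i * h i = ∑ i, extend v i * h i := by
  have : ∀ i : J, v i = extend v i := fun i => by simp [extend]
  simp_rw [this]
  rw [Finset.sum_coe_sort J fun i => extend v i * h i]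
  exact Finset.sum_subset (Finset.subset_univ J) fun i _ hi => by simp [extend, hi]

/-- The part of the Hessian that comes from the penalty is positive semidefinite. -/
lemma sum_mul_projection_nonneg (β : EuclideanSpace ℝ (Fin N)) (v : J → ℝ) :
    0 ≤ ∑ i : J, v i * (‖blockVec β (B.part i)‖⁻¹ •
        (Submodule.span ℝ {blockVec β (B.part i)})ᗮ.starProjection
          (blockVec (extend v) (B.part i))) ⟨i, B.mem_part (Finset.mem_univ _)⟩ := by
  rw [sum_extend_mul v fun i => (‖blockVec β (B.part i)‖⁻¹ •
        (Submodule.span ℝ {blockVec β (B.part i)})ᗮ.starProjection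
          (blockVec (extend v) (B.part i))) ⟨i, B.mem_part (Finset.mem_univ _)⟩, sum_parts B]
  refine Finset.sum_nonneg fun b hb => ?_
  have key : ∀ i : Fin N, ∀ hi : i ∈ b, extend v i * (‖blockVec β (B.part i)‖⁻¹ •
        (Submodule.span ℝ {blockVec β (B.part i)})ᗮ.starProjection
          (blockVec (extend v) (B.part i))) ⟨i, B.mem_part (Finset.mem_univ _)⟩
      = ‖blockVec β b‖⁻¹ * (((Submodule.span ℝ {blockVec β b})ᗮ.starProjection
          (blockVec (extend v) b)) ⟨i, hi⟩ * blockVec (extend v) b ⟨i, hi⟩) := by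
    intro i hi
    have hpart : B.part i = b := B.part_eq_of_mem hb hi
    subst hpart
    rw [PiLp.smul_apply, smul_eq_mul]
    simp only [blockVec]
    ring
  rw [Finset.sum_congr rfl fun (i : b) _ => key i i.2, ← Finset.mul_sum]
  have h2 := (Submodule.span ℝ {blockVec β b})ᗮ.re_inner_starProjection_nonneg
    (blockVec (extend v) b)
  rw [real_inner_comm] at h2
  exact mul_nonneg (inv_nonneg.2 (norm_nonneg _)) (by simpa [PiLp.inner_apply] using h2)

lemma cols_mulVec_injective (hX : LinearIndependent ℝ X.col) :
    Function.Injective (cols X J).mulVec :=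
  Matrix.mulVec_injective_iff.2 (hX.comp (Subtype.val : J → Fin N) Subtype.val_injective)

/-- The Hessian is the sum of the positive definite matrix `X_Jᵀ X_J` and of a positive
semidefinite one, hence invertible. -/
lemma isUnit_det_blockHessian (hX : LinearIndependent ℝ X.col) (hlam : 0 < lam)
    (β : EuclideanSpace ℝ (Fin N)) : IsUnit (blockHessian X B lam β J).det := by
  rw [← Matrix.isUnit_iff_isUnit_det, ← Matrix.mulVec_injective_iff_isUnit]
  refine (injective_iff_map_eq_zero (Matrix.mulVecLin (blockHessian X B lam β J))).2
    fun v hv => ?_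
  have h0 : ∑ i : J, v i * (blockHessian X B lam β J *ᵥ v) i = 0 :=
    Finset.sum_eq_zero fun i _ => by
      rw [show (blockHessian X B lam β J *ᵥ v) i = 0 from congrFun hv i, mul_zero]
  simp_rw [blockHessian_mulVec, mul_add, Finset.sum_add_distrib, mul_left_comm _ lam,
    ← Finset.mul_sum] at h0
  have h1 : ∑ i : J, v i * (((cols X J)ᵀ * cols X J) *ᵥ v) i
      = (cols X J *ᵥ v) ⬝ᵥ (cols X J *ᵥ v) := by
    change v ⬝ᵥ _ = _
    rw [← Matrix.mulVec_mulVec, Matrix.dotProduct_mulVec, Matrix.vecMul_transpose]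
  have h2 := mul_nonneg hlam.le (sum_mul_projection_nonneg B β v)
  have h3 : 0 ≤ (cols X J *ᵥ v) ⬝ᵥ (cols X J *ᵥ v) :=
    Finset.sum_nonneg fun i _ => mul_self_nonneg _
  have h4 : cols X J *ᵥ v = 0 := dotProduct_self_eq_zero.1 (by linarith)
  exact cols_mulVec_injective hX (h4.trans (Matrix.mulVec_zero _).symm)

/-- Off the transition set, the block support of the solution is locally constant. -/
lemma eventually_blockVec_solution (hX : LinearIndependent ℝ X.col) (hlam : 0 < lam)
    {y : EuclideanSpace ℝ (Fin Q)} (hy : y ∉ transitionSet X B lam) :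
    ∀ᶠ y' in 𝓝 y, ∀ b ∈ B.parts,
      blockVec (solution X B lam y') b ≠ 0 ↔ b ∈ bsupp B (solution X B lam y) := by
  have hcont := continuous_solution B hX hlam
  have hdes : Continuous (design X) := (design X).continuous_of_finiteDimensional
  rw [Filter.eventually_all_finset]
  intro b hb
  by_cases hbI : b ∈ bsupp B (solution X B lam y)
  · have h := ((continuous_blockVec b).comp hcont).continuousAt.eventually_ne
      (x := y) ((mem_bsupp_iff B).1 hbI).2
    filter_upwards [h] with y' h'
    exact iff_of_true h' hbI
  · have hlt : ‖blockGrad X b (y - design X (solution X B lam y))‖ < lam := by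
      refine lt_of_le_of_ne ((isSolution_solution B hX hlam y).optimality B hlam hb).1
        fun heq => hy ?_
      have hI : bsupp B (solution X B lam y) ⊆ B.parts := Finset.filter_subset _ _
      have hres := residual_eq (X := X) B hI (fun c hc hcI =>
        blockVec_eq_zero_of_notMem_bsupp B hc hcI) y
      refine Set.mem_biUnion (x := bsupp B (solution X B lam y)) (by simpa using hI)
        (Set.mem_biUnion (x := b) (by simpa using ⟨hb, hbI⟩)
          ⟨solution X B lam y, rfl, ?_, fun c hc => ?_⟩)
      · rw [hres]
        exact heq
      · rw [hres]
        exact ((isSolution_solution B hX hlam y).optimality B hlam (hI hc)).2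
          ((mem_bsupp_iff B).1 hc).2
    have hc : Continuous fun y' =>
        ‖blockGrad X b (y' - design X (solution X B lam y'))‖ :=
      ((continuous_blockGrad X b).comp (continuous_id.sub (hdes.comp hcont))).norm
    filter_upwards [hc.continuousAt.eventually_lt continuousAt_const hlt] with y' h'
    refine iff_of_false (fun hne => ?_) hbI
    -- On the block support the gradient of the loss has norm exactly `lam`.
    rw [((isSolution_solution B hX hlam y').optimality B hlam hb).2 hne, norm_smul,
      Real.norm_of_nonneg (by positivity), div_mul_cancel₀ _ (norm_ne_zero_iff.2 hne)] at h'
    exact lt_irrefl _ h'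

/-- The map `r ↦ X_Jᵀ r`. -/
noncomputable def colsTranspose (X : Matrix (Fin Q) (Fin N) ℝ) (J : Finset (Fin N)) :
    EuclideanSpace ℝ (Fin Q) →L[ℝ] (J → ℝ) :=
  (Matrix.mulVecLin (cols X J)ᵀ).toContinuousLinearMap ∘L
    (EuclideanSpace.equiv (Fin Q) ℝ).toContinuousLinearMap

/-- The map `u ↦ X_J u`. -/
noncomputable def colsMap (X : Matrix (Fin Q) (Fin N) ℝ) (J : Finset (Fin N)) :
    (J → ℝ) →L[ℝ] EuclideanSpace ℝ (Fin Q) :=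
  (EuclideanSpace.equiv (Fin Q) ℝ).symm.toContinuousLinearMap ∘L
    (Matrix.mulVecLin (cols X J)).toContinuousLinearMap

/-- A solution with block support `I` solves the stationarity equation on the indices of `I`. -/
lemma stationarityMap_solution (hX : LinearIndependent ℝ X.col) (hlam : 0 < lam)
    {I : Finset (Finset (Fin N))} (hI : I ⊆ B.parts) {y : EuclideanSpace ℝ (Fin Q)}
    (hy : ∀ b ∈ B.parts, blockVec (solution X B lam y) b ≠ 0 ↔ b ∈ I) :
    extend (fun i : indices I => solution X B lam y i) = ⇑(solution X B lam y) ∧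
    stationarityMap X B lam (indices I) (fun i => solution X B lam y i)
        = colsTranspose X (indices I) y ∧
      prediction X B lam y = colsMap X (indices I) (fun i => solution X B lam y i) := by
  set β := solution X B lam y with hβ
  have h0 : ∀ i ∉ indices I, β i = 0 := fun i hi => by
    refine apply_eq_zero_of_blockVec_eq_zero (not_not.1 fun hne => hi ?_)
      (B.mem_part (Finset.mem_univ i))
    exact (mem_indices_iff B hI i).2 ((hy _ (B.part_mem.2 (Finset.mem_univ i))).1 hne)
  have hext : extend (fun i : indices I => β i) = ⇑β := by
    funext i
    by_cases hi : i ∈ indices I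
    · simp [extend, hi]
    · simp [extend, hi, h0 i hi]
  have hcols : cols X (indices I) *ᵥ (fun i => β i) = X *ᵥ ⇑β := cols_mulVec_blockVec h0
  refine ⟨hext, ?_, ?_⟩
  · funext i
    have hpI := (mem_indices_iff B hI i).1 i.2
    have hpart := hI hpI
    have hopt := ((isSolution_solution B hX hlam y).optimality B hlam hpart).2
      ((hy _ hpart).2 hpI)
    have hi := congrArg (fun w : EuclideanSpace ℝ (B.part i) =>
      w ⟨i, B.mem_part (Finset.mem_univ _)⟩) hopt
    have hg : (blockGrad X (B.part i) (y - design X β)) ⟨i, B.mem_part (Finset.mem_univ _)⟩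
        = ((cols X (indices I))ᵀ *ᵥ ⇑y) i - ((cols X (indices I))ᵀ *ᵥ (X *ᵥ ⇑β)) i := by
      rw [← Pi.sub_apply, ← Matrix.mulVec_sub]
      rfl
    simp only [← hβ] at hi
    rw [hg] at hi
    rw [stationarityMap, blockExt_apply, hext, ← Matrix.mulVec_mulVec, hcols]
    change _ = ((cols X (indices I))ᵀ *ᵥ ⇑y) i
    rw [PiLp.smul_apply, smul_eq_mul] at hi ⊢
    rw [← mul_assoc, ← div_eq_mul_inv, ← hi]
    ring
  · change WithLp.toLp 2 (X *ᵥ ⇑β) = WithLp.toLp 2 (cols X (indices I) *ᵥ fun i => β i)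
    rw [hcols]

/-- Near a point off the transition set the prediction is `X_I Φ⁻¹(X_Iᵀ y)`, where `Φ` is the
stationarity map on the block support; the inverse function theorem applies to `Φ`. -/
theorem prediction_smooth (hX : LinearIndependent ℝ X.col) (hlam : 0 < lam)
    {y : EuclideanSpace ℝ (Fin Q)} (hy : y ∉ transitionSet X B lam) :
    ContDiffAt ℝ 1 (prediction X B lam) y ∧
      IsUnit (hessian X B lam (solution X B lam y)).det ∧
      divergence (prediction X B lam) y = dofEstimate X B lam y := by
  have hI : bsupp B (solution X B lam y) ⊆ B.parts := Finset.filter_subset _ _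
  set J := indices (bsupp B (solution X B lam y)) with hJ
  set H := blockHessian X B lam (solution X B lam y) J with hH
  have hdet : IsUnit H.det := isUnit_det_blockHessian B hX hlam _
  let f' : (J → ℝ) ≃L[ℝ] (J → ℝ) := ContinuousLinearEquiv.equivOfInverse
    (Matrix.mulVecLin H).toContinuousLinearMap (Matrix.mulVecLin H⁻¹).toContinuousLinearMap
    (fun v => by
      change H⁻¹ *ᵥ (H *ᵥ v) = v
      rw [Matrix.mulVec_mulVec, Matrix.nonsing_inv_mul _ hdet, Matrix.one_mulVec])
    (fun v => by
      change H *ᵥ (H⁻¹ *ᵥ v) = v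
      rw [Matrix.mulVec_mulVec, Matrix.mul_nonsing_inv _ hdet, Matrix.one_mulVec])
  let u : EuclideanSpace ℝ (Fin Q) → (J → ℝ) := fun y' i => solution X B lam y' i
  have hev := eventually_blockVec_solution B hX hlam hy
  obtain ⟨hext, hstat, -⟩ := stationarityMap_solution B hX hlam hI hev.self_of_nhds
  have hne : ∀ i : J, blockVec (solution X B lam y) (B.part i) ≠ 0 := fun i =>
    ((mem_bsupp_iff B).1 ((mem_indices_iff B hI i).1 i.2)).2
  have hblock : ∀ i : J, blockVec (extend (u y)) (B.part i)
      = blockVec (solution X B lam y) (B.part i) := fun i =>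
    congrArg (fun w => blockVec w (B.part i)) hext
  have hC : ContDiffAt ℝ 1 (stationarityMap X B lam J) (u y) :=
    contDiffAt_stationarityMap B fun i => by rw [hblock]; exact hne i
  have hD : HasFDerivAt (stationarityMap X B lam J) (f' : (J → ℝ) →L[ℝ] (J → ℝ)) (u y) :=
    hasFDerivAt_stationarityMap B hblock hne
  have hS := hC.hasStrictFDerivAt' hD one_ne_zero
  set g := hC.localInverse hD one_ne_zero with hg
  have hstat' : stationarityMap X B lam J (u y) = colsTranspose X J y := hstat
  have hgC : ContDiffAt ℝ 1 g (colsTranspose X J y) := by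
    rw [← hstat']
    exact hC.to_localInverse hD one_ne_zero
  have hgD : HasFDerivAt g (f'.symm : (J → ℝ) →L[ℝ] (J → ℝ)) (colsTranspose X J y) := by
    rw [← hstat']
    exact hS.to_localInverse.hasFDerivAt
  have hu : Tendsto u (𝓝 y) (𝓝 (u y)) := by
    refine Continuous.tendsto (continuous_pi fun i => ?_) y
    exact (EuclideanSpace.proj (𝕜 := ℝ) (i : Fin N)).continuous.comp (continuous_solution B hX hlam)
  have heq : prediction X B lam =ᶠ[𝓝 y] fun y' => colsMap X J (g (colsTranspose X J y')) := by
    filter_upwards [hev, hu.eventually hS.eventually_left_inverse] with y' h1 h2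
    obtain ⟨-, h3, h4⟩ := stationarityMap_solution B hX hlam hI h1
    rw [h4]
    congr 1
    rw [← h3]
    exact h2.symm
  refine ⟨?_, hdet, ?_⟩
  · refine ContDiffAt.congr_of_eventuallyEq ?_ heq
    exact (colsMap X J).contDiff.contDiffAt.comp y
      (hgC.comp y (colsTranspose X J).contDiff.contDiffAt)
  · have hF := ((colsMap X J).hasFDerivAt.comp y
      (hgD.comp y (colsTranspose X J).hasFDerivAt)).congr_of_eventuallyEq heq
    rw [divergence, hF.fderiv, dofEstimate, Matrix.trace]
    refine Finset.sum_congr rfl fun i _ => ?_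
    change (cols X J *ᵥ (H⁻¹ *ᵥ ((cols X J)ᵀ *ᵥ ⇑(EuclideanSpace.single i (1 : ℝ))))) i
      = (cols X J * (H⁻¹ * (cols X J)ᵀ)) i i
    rw [Matrix.mulVec_mulVec, Matrix.mulVec_mulVec, PiLp.ofLp_single,
      Matrix.mulVec_single_one, Matrix.mul_assoc]
    rfl

end

/-! ### Stein's identity for Lipschitz functions -/

section

section Gaussian

lemma abs_le_of_lipschitz {V : Type*} [SeminormedAddCommGroup V] {C : NNReal} {f : V → ℝ} (hf : LipschitzWith C f) (x : V) :
    |f x| ≤ (|f 0| + C) * (1 + ‖x‖) := by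
  have h := hf.dist_le_mul x 0
  rw [Real.dist_eq, dist_zero_right] at h
  have h2 := abs_sub_abs_le_abs_sub (f x) (f 0)
  nlinarith [mul_nonneg (abs_nonneg (f 0)) (norm_nonneg x), C.2]

variable {V : Type*} [NormedAddCommGroup V] [InnerProductSpace ℝ V]

/-- The density of the standard Gaussian measure. -/
noncomputable def stdGaussianPDF (x : V) : ℝ :=
  ((2 * Real.pi) ^ ((Module.finrank ℝ V : ℝ) / 2))⁻¹ * Real.exp (-(1 / 2) * ‖x‖ ^ 2)

lemma stdGaussianPDF_nonneg (x : V) : 0 ≤ stdGaussianPDF x := by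
  unfold stdGaussianPDF
  positivity

lemma continuous_stdGaussianPDF : Continuous (stdGaussianPDF : V → ℝ) := by
  unfold stdGaussianPDF
  fun_prop

lemma hasDerivAt_stdGaussianPDF_sub_smul (x v : V) (s : ℝ) :
    HasDerivAt (fun s : ℝ => stdGaussianPDF (x - s • v))
      (⟪v, x - s • v⟫ * stdGaussianPDF (x - s • v)) s := by
  have h1 : HasDerivAt (fun s : ℝ => x - s • v) (-v) s := by
    simpa using ((hasDerivAt_id s).smul_const v).const_sub x
  have h2 := ((h1.norm_sq.const_mul (-(1 / 2))).exp).const_mul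
    ((2 * Real.pi) ^ ((Module.finrank ℝ V : ℝ) / 2))⁻¹
  refine h2.congr_deriv ?_
  rw [stdGaussianPDF, inner_neg_right, real_inner_comm]
  ring

lemma stdGaussianPDF_sub_smul_le (x v : V) {s : ℝ} (hs : |s| ≤ 1) :
    stdGaussianPDF (x - s • v)
      ≤ ((2 * Real.pi) ^ ((Module.finrank ℝ V : ℝ) / 2))⁻¹ * Real.exp (1 / 2 * ‖v‖ ^ 2) *
        Real.exp (-(1 / 4) * ‖x‖ ^ 2) := by
  rw [stdGaussianPDF, mul_assoc _ (Real.exp _), ← Real.exp_add]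
  have h1 : ‖x‖ ≤ ‖x - s • v‖ + ‖v‖ := by
    have h2 : ‖s • v‖ ≤ ‖v‖ := by
      rw [norm_smul, Real.norm_eq_abs]
      exact mul_le_of_le_one_left (norm_nonneg v) hs
    calc ‖x‖ = ‖(x - s • v) + s • v‖ := by rw [sub_add_cancel]
      _ ≤ _ := (norm_add_le _ _).trans (by gcongr)
  gcongr
  nlinarith [sq_nonneg (‖x - s • v‖ - ‖v‖), norm_nonneg x]

variable [FiniteDimensional ℝ V] [MeasurableSpace V] [BorelSpace V]

lemma integrable_exp_neg_mul_sq_norm {b : ℝ} (hb : 0 < b) :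
    Integrable fun x : V => Real.exp (-b * ‖x‖ ^ 2) := by
  have h := (GaussianFourier.integrable_cexp_neg_mul_sq_norm_add (V := V) (b := (b : ℂ))
    (by simpa using hb) 0 0).norm
  refine h.congr (Eventually.of_forall fun x => ?_)
  simp only [Complex.norm_exp, zero_mul, add_zero]
  congr 1
  norm_cast

lemma integrable_stdGaussianPDF : Integrable (stdGaussianPDF : V → ℝ) :=
  (integrable_exp_neg_mul_sq_norm (by norm_num)).const_mul _

/-- The standard Gaussian measure and the measure with density `stdGaussianPDF` have the same
characteristic function. -/
lemma stdGaussian_eq_withDensity :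
    stdGaussian V = volume.withDensity fun x => ENNReal.ofReal (stdGaussianPDF x) := by
  have : IsFiniteMeasure (volume.withDensity fun x : V => ENNReal.ofReal (stdGaussianPDF x)) :=
    isFiniteMeasure_withDensity_ofReal integrable_stdGaussianPDF.2
  refine Measure.ext_of_charFun (funext fun t => ?_)
  rw [charFun_stdGaussian, charFun_apply, integral_withDensity_eq_integral_toReal_smul
    (by exact continuous_stdGaussianPDF.measurable.ennreal_ofReal)
    (Eventually.of_forall fun _ => ENNReal.ofReal_lt_top)]
  have h1 : ∀ x : V, (ENNReal.ofReal (stdGaussianPDF x)).toReal • Complex.exp (⟪x, t⟫ * Complex.I)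
      = (((2 * Real.pi) ^ ((Module.finrank ℝ V : ℝ) / 2))⁻¹ : ℝ) *
        Complex.exp (-(1 / 2 : ℂ) * ‖x‖ ^ 2 + Complex.I * ⟪t, x⟫) := by
    intro x
    rw [ENNReal.toReal_ofReal (stdGaussianPDF_nonneg x), stdGaussianPDF, Complex.real_smul,
      Complex.ofReal_mul, Complex.ofReal_exp, mul_assoc, ← Complex.exp_add, real_inner_comm,
      mul_comm Complex.I]
    push_cast
    rfl
  simp_rw [h1]
  rw [integral_const_mul, GaussianFourier.integral_cexp_neg_mul_sq_norm_add (by norm_num)]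
  have h2 : ((Real.pi : ℂ) / (1 / 2)) ^ ((Module.finrank ℝ V : ℂ) / 2)
      = (((2 * Real.pi) ^ ((Module.finrank ℝ V : ℝ) / 2) : ℝ) : ℂ) := by
    rw [Complex.ofReal_cpow (by positivity)]
    push_cast
    congr 1
    ring
  have h3 : (0 : ℝ) < (2 * Real.pi) ^ ((Module.finrank ℝ V : ℝ) / 2) := by positivity
  rw [h2, ← mul_assoc, ← Complex.ofReal_mul, inv_mul_cancel₀ h3.ne', Complex.ofReal_one, one_mul]
  congr 1
  rw [Complex.I_sq]
  ring

lemma integral_stdGaussian (g : V → ℝ) :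
    ∫ x, g x ∂(stdGaussian V) = ∫ x, g x * stdGaussianPDF x := by
  rw [stdGaussian_eq_withDensity, integral_withDensity_eq_integral_toReal_smul
    (by exact continuous_stdGaussianPDF.measurable.ennreal_ofReal)
    (Eventually.of_forall fun _ => ENNReal.ofReal_lt_top)]
  refine integral_congr_ae (Eventually.of_forall fun x => ?_)
  simp only [ENNReal.toReal_ofReal (stdGaussianPDF_nonneg x), smul_eq_mul, mul_comm]

lemma stdGaussian_absolutelyContinuous : stdGaussian V ≪ volume := by
  rw [stdGaussian_eq_withDensity]
  exact withDensity_absolutelyContinuous _ _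

lemma integrable_sq_mul_exp :
    Integrable fun x : V => (1 + ‖x‖) ^ 2 * Real.exp (-(1 / 4) * ‖x‖ ^ 2) := by
  refine ((integrable_exp_neg_mul_sq_norm (V := V) (b := 1 / 8) (by norm_num)).const_mul 16).mono'
    (Continuous.aestronglyMeasurable (by fun_prop)) (Eventually.of_forall fun x => ?_)
  rw [Real.norm_of_nonneg (by positivity)]
  have h1 : (1 + ‖x‖) ^ 2 ≤ 16 * Real.exp (1 / 8 * ‖x‖ ^ 2) := by
    have := Real.add_one_le_exp (1 / 8 * ‖x‖ ^ 2)
    nlinarith [sq_nonneg (‖x‖ - 1)]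
  calc (1 + ‖x‖) ^ 2 * Real.exp (-(1 / 4) * ‖x‖ ^ 2)
      ≤ 16 * Real.exp (1 / 8 * ‖x‖ ^ 2) * Real.exp (-(1 / 4) * ‖x‖ ^ 2) := by gcongr
    _ = 16 * Real.exp (-(1 / 8) * ‖x‖ ^ 2) := by
      rw [mul_assoc, ← Real.exp_add]
      congr 2
      ring

lemma memLp_two_of_lipschitz {μ : Measure V} [IsGaussian μ] {C : NNReal} {f : V → ℝ}
    (hf : LipschitzWith C f) : MemLp f 2 μ := by
  have h1 : MemLp (fun x : V => (|f 0| + C) * (1 + ‖x‖)) 2 μ :=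
    ((memLp_const (1 : ℝ)).add (IsGaussian.memLp_two_id (μ := μ)).norm).const_mul _
  refine h1.mono hf.continuous.aestronglyMeasurable (Eventually.of_forall fun x => ?_)
  rw [Real.norm_eq_abs]
  exact (abs_le_of_lipschitz hf x).trans (le_abs_self _)

lemma integrable_mul_stdGaussianPDF {C : NNReal} {f : V → ℝ} (hf : LipschitzWith C f) :
    Integrable fun x => f x * stdGaussianPDF x := by
  have h : Integrable f (stdGaussian V) := (memLp_two_of_lipschitz hf).integrable one_le_two
  rw [stdGaussian_eq_withDensity, integrable_withDensity_iff_integrable_smul'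
    (by exact continuous_stdGaussianPDF.measurable.ennreal_ofReal)
    (Eventually.of_forall fun _ => ENNReal.ofReal_lt_top)] at h
  refine h.congr (Eventually.of_forall fun x => ?_)
  simp only [ENNReal.toReal_ofReal (stdGaussianPDF_nonneg x), smul_eq_mul, mul_comm]

/-- Stein's identity for a Lipschitz function: both sides are the derivative at `s = 0` of
`∫ f (x + s v) p(x) dx = ∫ f x p(x - s v) dx`, with `p` the Gaussian density. -/
lemma integral_lineDeriv_stdGaussian {C : NNReal} {f : V → ℝ} (hf : LipschitzWith C f) (v : V) :
    ∫ x, lineDeriv ℝ f x v ∂(stdGaussian V) = ∫ x, f x * ⟪v, x⟫ ∂(stdGaussian V) := by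
  rw [integral_stdGaussian, integral_stdGaussian]
  have hp_cont : Continuous (stdGaussianPDF : V → ℝ) := continuous_stdGaussianPDF
  have hf_cont := hf.continuous
  set K : ℝ := (|f 0| + C) * (‖v‖ * (1 + ‖v‖)) *
    (((2 * Real.pi) ^ ((Module.finrank ℝ V : ℝ) / 2))⁻¹ * Real.exp (1 / 2 * ‖v‖ ^ 2)) with hK
  have hbound : ∀ x : V, ∀ s ∈ Metric.ball (0 : ℝ) 1,
      ‖f x * (⟪v, x - s • v⟫ * stdGaussianPDF (x - s • v))‖
        ≤ K * ((1 + ‖x‖) ^ 2 * Real.exp (-(1 / 4) * ‖x‖ ^ 2)) := by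
    intro x s hs
    have hs1 : |s| ≤ 1 := by simpa using (mem_ball_zero_iff.1 hs).le
    have h2 : |⟪v, x - s • v⟫| ≤ ‖v‖ * ((1 + ‖v‖) * (1 + ‖x‖)) := by
      refine (abs_real_inner_le_norm _ _).trans (mul_le_mul_of_nonneg_left ?_ (norm_nonneg v))
      have h3 : ‖s • v‖ ≤ ‖v‖ := by
        rw [norm_smul, Real.norm_eq_abs]
        exact mul_le_of_le_one_left (norm_nonneg v) hs1
      nlinarith [norm_sub_le x (s • v), mul_nonneg (norm_nonneg v) (norm_nonneg x)]
    rw [norm_mul, norm_mul, Real.norm_eq_abs, Real.norm_eq_abs,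
      Real.norm_of_nonneg (stdGaussianPDF_nonneg _)]
    calc |f x| * (|⟪v, x - s • v⟫| * stdGaussianPDF (x - s • v))
        ≤ ((|f 0| + C) * (1 + ‖x‖)) * ((‖v‖ * ((1 + ‖v‖) * (1 + ‖x‖))) *
          (((2 * Real.pi) ^ ((Module.finrank ℝ V : ℝ) / 2))⁻¹ * Real.exp (1 / 2 * ‖v‖ ^ 2) *
            Real.exp (-(1 / 4) * ‖x‖ ^ 2))) := by
          gcongr
          · exact mul_nonneg (abs_nonneg _) (stdGaussianPDF_nonneg _)
          · exact abs_le_of_lipschitz hf x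
          · exact stdGaussianPDF_nonneg (x - s • v)
          · exact stdGaussianPDF_sub_smul_le x v hs1
      _ = _ := by rw [hK]; ring
  have hder := (hasDerivAt_integral_of_dominated_loc_of_deriv_le (μ := (volume : Measure V))
    (F := fun s x => f x * stdGaussianPDF (x - s • v))
    (F' := fun s x => f x * (⟪v, x - s • v⟫ * stdGaussianPDF (x - s • v))) (x₀ := (0 : ℝ))
    (Metric.ball_mem_nhds 0 one_pos)
    (Eventually.of_forall fun s => Continuous.aestronglyMeasurable (by fun_prop))
    (by simpa using integrable_mul_stdGaussianPDF hf)
    (Continuous.aestronglyMeasurable (by fun_prop))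
    (Eventually.of_forall hbound) (integrable_sq_mul_exp.const_mul K)
    (Eventually.of_forall fun x s _ =>
      (hasDerivAt_stdGaussianPDF_sub_smul x v s).const_mul (f x))).2.tendsto_slope_zero_right
  have hshift : ∀ s : ℝ, ∫ x, f x * stdGaussianPDF (x - s • v)
      = ∫ x, f (x + s • v) * stdGaussianPDF x := fun s => by
    rw [← integral_add_right_eq_self _ (s • v)]
    simp
  have hslope : ∀ t : ℝ, t⁻¹ • ((∫ x, f x * stdGaussianPDF (x - (0 + t) • v))
        - ∫ x, f x * stdGaussianPDF (x - (0 : ℝ) • v))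
      = ∫ x, (t⁻¹ • (f (x + t • v) - f x)) * stdGaussianPDF x := fun t => by
    have hft : LipschitzWith C fun x => f (x + t • v) := by
      refine LipschitzWith.of_dist_le_mul fun a b => ?_
      simpa using hf.dist_le_mul (a + t • v) (b + t • v)
    rw [hshift, hshift, zero_add, zero_smul]
    simp only [add_zero]
    rw [← integral_sub (integrable_mul_stdGaussianPDF hft) (integrable_mul_stdGaussianPDF hf),
      smul_eq_mul, ← integral_const_mul]
    refine integral_congr_ae (Eventually.of_forall fun x => ?_)
    simp only [smul_eq_mul]
    ring
  simp only [hslope] at hder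
  refine (tendsto_nhds_unique (hf.integral_inv_smul_sub_mul_tendsto_integral_lineDeriv_mul
    integrable_stdGaussianPDF v) hder).trans ?_
  simp [mul_assoc]

end Gaussian

section ScaledGaussian

variable {Q : ℕ}

lemma multivariateGaussian_scalar {σ : ℝ} (hσ : 0 < σ) :
    multivariateGaussian 0 (σ ^ 2 • (1 : Matrix (Fin Q) (Fin Q) ℝ))
      = (stdGaussian (EuclideanSpace ℝ (Fin Q))).map fun x => σ • x := by
  open scoped MatrixOrder in
  have hsqrt : CFC.sqrt (σ ^ 2 • (1 : Matrix (Fin Q) (Fin Q) ℝ)) = σ • 1 := by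
    refine CFC.sqrt_unique ?_ ?_
    · rw [smul_mul_smul_comm, one_mul, sq]
    · exact (Matrix.PosSemidef.one.smul hσ.le).nonneg
  rw [multivariateGaussian, hsqrt]
  congr 1
  funext x
  simp

lemma multivariateGaussian_scalar_absolutelyContinuous {σ : ℝ} (hσ : 0 < σ) :
    multivariateGaussian 0 (σ ^ 2 • (1 : Matrix (Fin Q) (Fin Q) ℝ)) ≪ volume := by
  rw [multivariateGaussian_scalar hσ]
  refine (stdGaussian_absolutelyContinuous.map (by fun_prop)).trans ?_
  rw [Measure.map_addHaar_smul _ hσ.ne']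
  exact Measure.smul_absolutelyContinuous

/-- Stein's identity for the centred Gaussian measure with covariance `σ² Id`. -/
lemma integral_lineDeriv_multivariateGaussian {σ : ℝ} (hσ : 0 < σ) {C : NNReal}
    {f : EuclideanSpace ℝ (Fin Q) → ℝ} (hf : LipschitzWith C f) (v : EuclideanSpace ℝ (Fin Q)) :
    ∫ x, f x * ⟪v, x⟫ ∂(multivariateGaussian 0 (σ ^ 2 • (1 : Matrix (Fin Q) (Fin Q) ℝ)))
      = σ ^ 2 * ∫ x, lineDeriv ℝ f x v
        ∂(multivariateGaussian 0 (σ ^ 2 • (1 : Matrix (Fin Q) (Fin Q) ℝ))) := by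
  have hf_cont := hf.continuous
  rw [multivariateGaussian_scalar hσ,
    integral_map (by fun_prop) (Continuous.aestronglyMeasurable (by fun_prop)),
    integral_map (by fun_prop) (aestronglyMeasurable_lineDeriv hf.continuous _)]
  have hfσ : LipschitzWith (C * ‖σ‖₊) fun x => f (σ • x) := hf.comp (lipschitzWith_smul σ)
  have hline : ∀ x, lineDeriv ℝ (fun x => f (σ • x)) x v = σ * lineDeriv ℝ f (σ • x) v := by
    intro x
    rw [← smul_eq_mul, ← lineDeriv_smul]
    simp only [lineDeriv, smul_add, smul_comm σ]
  have h := integral_lineDeriv_stdGaussian hfσ v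
  simp_rw [hline, integral_const_mul] at h
  rw [sq, mul_assoc, h, ← integral_const_mul]
  refine integral_congr_ae (Eventually.of_forall fun x => ?_)
  simp only [inner_smul_right]
  ring

end ScaledGaussian

end

/-! ### Degrees of freedom under Gaussian noise -/

section

variable {Q N : ℕ} {X : Matrix (Fin Q) (Fin N) ℝ}
  (B : Finpartition (Finset.univ : Finset (Fin N))) {lam : ℝ}

lemma lipschitzWith_coord {C : NNReal} {f : EuclideanSpace ℝ (Fin Q) → EuclideanSpace ℝ (Fin Q)}
    (hf : LipschitzWith C f) (m : EuclideanSpace ℝ (Fin Q)) (i : Fin Q) :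
    LipschitzWith C fun x => f (m + x) i := by
  refine LipschitzWith.of_dist_le_mul fun a b => ?_
  have h1 := hf.dist_le_mul (m + a) (m + b)
  rw [dist_add_left] at h1
  refine le_trans ?_ h1
  rw [dist_eq_norm, dist_eq_norm]
  exact PiLp.norm_apply_le (f (m + a) - f (m + b)) i

lemma divergence_eq_sum_lineDeriv
    {f : EuclideanSpace ℝ (Fin Q) → EuclideanSpace ℝ (Fin Q)} (m x : EuclideanSpace ℝ (Fin Q))
    (hf : DifferentiableAt ℝ f (m + x)) :
    divergence f (m + x)
      = ∑ i, lineDeriv ℝ (fun x => f (m + x) i) x (EuclideanSpace.single i 1) := by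
  refine Finset.sum_congr rfl fun i _ => ?_
  have h := (EuclideanSpace.proj (𝕜 := ℝ) i).hasFDerivAt.comp x
    (hf.hasFDerivAt.comp x ((hasFDerivAt_id x).const_add m))
  exact (h.hasLineDerivAt (EuclideanSpace.single i 1)).lineDeriv.symm

/-- Stein's identity: for a Lipschitz estimator and Gaussian noise, the mean of the divergence is
the number of degrees of freedom. The divergence is computed by the line derivatives, which
exist almost everywhere and are bounded. -/
lemma isUnbiased_sum_lineDeriv {σ : ℝ} (hσ : 0 < σ) {C : NNReal}
    {f : EuclideanSpace ℝ (Fin Q) → EuclideanSpace ℝ (Fin Q)} (hf : LipschitzWith C f)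
    (m : EuclideanSpace ℝ (Fin Q)) {Ω : Type*} [MeasurableSpace Ω] {P : Measure Ω}
    [IsProbabilityMeasure P] {ε y : Ω → EuclideanSpace ℝ (Fin Q)}
    (hε : HasLaw ε (multivariateGaussian 0 (σ ^ 2 • (1 : Matrix (Fin Q) (Fin Q) ℝ))) P)
    (hy : ∀ ω, y ω = m + ε ω) :
    (∀ i, MemLp (fun ω => y ω i) 2 P) ∧ (∀ i, MemLp (fun ω => f (y ω) i) 2 P) ∧
      IsUnbiased P (fun ω => ∑ i, lineDeriv ℝ (fun x => f (m + x) i) (ε ω)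
        (EuclideanSpace.single i 1)) (dof P σ y f) := by
  obtain rfl : y = fun ω => m + ε ω := funext hy
  set μ := multivariateGaussian 0 (σ ^ 2 • (1 : Matrix (Fin Q) (Fin Q) ℝ)) with hμ
  have hεm := hε.aemeasurable
  have hLp : ∀ {D : NNReal} {g : EuclideanSpace ℝ (Fin Q) → ℝ}, LipschitzWith D g →
      MemLp (fun ω => g (ε ω)) 2 P := fun {D g} hg => by
    have h : MemLp g 2 (P.map ε) := by
      rw [hε.map_eq]
      exact memLp_two_of_lipschitz hg
    exact h.comp_of_map hεm
  have hcoord : ∀ i, LipschitzWith C fun x => f (m + x) i := lipschitzWith_coord hf m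
  have hid : ∀ i, LipschitzWith 1 fun x : EuclideanSpace ℝ (Fin Q) => x i := fun i => by
    simpa using lipschitzWith_coord (LipschitzWith.id) (0 : EuclideanSpace ℝ (Fin Q)) i
  have hmid : ∀ i, LipschitzWith 1 fun x : EuclideanSpace ℝ (Fin Q) => (m + x) i := fun i =>
    lipschitzWith_coord (LipschitzWith.id) m i
  have hmeas : ∀ i, Measurable fun x => lineDeriv ℝ (fun x => f (m + x) i) x
      (EuclideanSpace.single i 1) := fun i => measurable_lineDeriv (hcoord i).continuous
  have hint : ∀ i, Integrable (fun x => lineDeriv ℝ (fun x => f (m + x) i) x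
      (EuclideanSpace.single i 1)) μ := fun i =>
    ((hcoord i).memLp_lineDeriv _).integrable le_top
  have hintP : ∀ i, Integrable (fun ω => lineDeriv ℝ (fun x => f (m + x) i) (ε ω)
      (EuclideanSpace.single i 1)) P := fun i => by
    have h := hint i
    rw [← hε.map_eq] at h
    exact h.comp_aemeasurable hεm
  refine ⟨fun i => hLp (hmid i), fun i => hLp (hcoord i),
    integrable_finsetSum _ fun i _ => hintP i, ?_⟩
  rw [integral_finsetSum _ fun i _ => hintP i, dof]
  refine Finset.sum_congr rfl fun i _ => ?_
  have hlaw : ∀ {g : EuclideanSpace ℝ (Fin Q) → ℝ}, Measurable g →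
      ∫ ω, g (ε ω) ∂P = ∫ x, g x ∂μ := fun hg =>
    hε.integral_comp hg.aestronglyMeasurable
  have hmean : ∫ ω, ε ω i ∂P = 0 := by
    rw [hlaw (g := fun x => x i) (hid i).continuous.measurable]
    have h := (EuclideanSpace.proj (𝕜 := ℝ) i : EuclideanSpace ℝ (Fin Q) →L[ℝ] ℝ
      ).integral_comp_id_comm (μ := μ) IsGaussian.integrable_id
    rw [integral_id_multivariateGaussian, map_zero] at h
    exact h
  have hcov : cov[fun ω => (m + ε ω) i, fun ω => f (m + ε ω) i; P]
      = ∫ ω, ε ω i * f (m + ε ω) i ∂P := by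
    have h : (fun ω => (m + ε ω) i) = fun ω => m i + ε ω i := rfl
    rw [h, covariance_const_add_left ((hLp (hid i)).integrable one_le_two),
      covariance_eq_sub (hLp (hid i)) (hLp (hcoord i)), hmean, zero_mul, sub_zero]
    rfl
  rw [hcov, hlaw (hmeas i), hlaw (g := fun x => x i * f (m + x) i)
    ((hid i).continuous.mul (hcoord i).continuous).measurable, eq_div_iff (by positivity), mul_comm,
    ← integral_lineDeriv_multivariateGaussian hσ (hcoord i)]
  refine integral_congr_ae (Eventually.of_forall fun x => ?_)
  simp [EuclideanSpace.inner_single_left, mul_comm]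

/-- Under Gaussian noise the observation almost surely avoids the transition set. -/
lemma ae_notMem_transitionSet (hX : LinearIndependent ℝ X.col) (hlam : 0 < lam) {σ : ℝ}
    (hσ : 0 < σ) (m : EuclideanSpace ℝ (Fin Q)) {Ω : Type*} [MeasurableSpace Ω] {P : Measure Ω}
    {ε : Ω → EuclideanSpace ℝ (Fin Q)}
    (hε : HasLaw ε (multivariateGaussian 0 (σ ^ 2 • (1 : Matrix (Fin Q) (Fin Q) ℝ))) P) :
    ∀ᵐ ω ∂P, m + ε ω ∉ transitionSet X B lam := by
  refine ae_of_ae_map (p := fun x => m + x ∉ transitionSet X B lam) hε.aemeasurable ?_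
  rw [hε.map_eq]
  have h : ∀ᵐ x ∂(volume : Measure (EuclideanSpace ℝ (Fin Q))),
      m + x ∉ transitionSet X B lam := by
    rw [ae_iff]
    simp only [not_not]
    exact (measure_preimage_add volume m _).trans (volume_transitionSet B hX hlam)
  exact (multivariateGaussian_scalar_absolutelyContinuous hσ).ae_le h

end

end GroupLasso

theorem theorem2 {Q N : ℕ} (X : Matrix (Fin Q) (Fin N) ℝ) (hX : LinearIndependent ℝ X.col)
    (B : Finpartition (Finset.univ : Finset (Fin N))) (lam : ℝ) (hlam : 0 < lam) :
    -- the group Lasso has exactly one solution, and it is `solution X B lam y`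
    (∀ y, IsSolution X B lam y (solution X B lam y) ∧
      ∀ β, IsSolution X B lam y β → β = solution X B lam y) ∧
    -- the prediction is `C¹` off the transition set, and its divergence there is `tr(X_I d(y))`
    (∀ y ∉ transitionSet X B lam,
      ContDiffAt ℝ 1 (prediction X B lam) y ∧
      IsUnit (hessian X B lam (solution X B lam y)).det ∧
      divergence (prediction X B lam) y = dofEstimate X B lam y) ∧
    -- the transition set is a Lebesgue null set
    volume (transitionSet X B lam) = 0 ∧
    -- under Gaussian noise, the divergence is an unbiased estimator of the degrees of freedom
    (∀ (β₀ : EuclideanSpace ℝ (Fin N)) (σ : ℝ), 0 < σ →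
      ∀ {Ω : Type*} [MeasurableSpace Ω] (P : Measure Ω) [IsProbabilityMeasure P]
        (ε y : Ω → EuclideanSpace ℝ (Fin Q)),
        HasLaw ε (multivariateGaussian 0 (σ ^ 2 • (1 : Matrix (Fin Q) (Fin Q) ℝ))) P →
        (∀ ω, y ω = WithLp.toLp 2 (X *ᵥ ⇑β₀) + ε ω) →
        (∀ i, MemLp (fun ω => y ω i) 2 P) ∧
        (∀ i, MemLp (fun ω => prediction X B lam (y ω) i) 2 P) ∧
        (∀ᵐ ω ∂P, divergence (prediction X B lam) (y ω) = dofEstimate X B lam (y ω)) ∧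
        IsUnbiased P (fun ω => divergence (prediction X B lam) (y ω))
          (dof P σ y (prediction X B lam)) ∧
        IsUnbiased P (fun ω => dofEstimate X B lam (y ω))
          (dof P σ y (prediction X B lam))) := by
  refine ⟨fun y => ⟨isSolution_solution B hX hlam y, fun β h => eq_solution B hX hlam h⟩,
    fun y hy => prediction_smooth B hX hlam hy, volume_transitionSet B hX hlam, ?_⟩
  intro β₀ σ hσ Ω _ P _ ε y hε hy
  have hae : ∀ᵐ ω ∂P, y ω ∉ transitionSet X B lam := by
    filter_upwards [ae_notMem_transitionSet B hX hlam hσ (WithLp.toLp 2 (X *ᵥ ⇑β₀)) hε] with ω h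
    rwa [hy]
  have hdiv : ∀ᵐ ω ∂P,
      divergence (prediction X B lam) (y ω) = dofEstimate X B lam (y ω) := by
    filter_upwards [hae] with ω h using (prediction_smooth B hX hlam h).2.2
  obtain ⟨h1, h2, h3⟩ := isUnbiased_sum_lineDeriv hσ (lipschitzWith_prediction B hX hlam)
    (WithLp.toLp 2 (X *ᵥ ⇑β₀)) hε hy
  have hline : (fun ω => ∑ i, lineDeriv ℝ (fun x => prediction X B lam
      (WithLp.toLp 2 (X *ᵥ ⇑β₀) + x) i) (ε ω) (EuclideanSpace.single i 1))
      =ᵐ[P] fun ω => divergence (prediction X B lam) (y ω) := by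
    filter_upwards [hae] with ω h
    have hd := (prediction_smooth B hX hlam h).1.differentiableAt one_ne_zero
    rw [hy ω] at hd ⊢
    exact (divergence_eq_sum_lineDeriv _ _ hd).symm
  have hU : IsUnbiased P (fun ω => divergence (prediction X B lam) (y ω))
      (dof P σ y (prediction X B lam)) :=
    ⟨h3.1.congr hline, (integral_congr_ae hline).symm.trans h3.2⟩
  exact ⟨h1, h2, hdiv, hU, hU.1.congr hdiv, (integral_congr_ae hdiv).symm.trans hU.2⟩
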